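/- **Setting.** A grid diagram $G$ of grid number $n$ is an $n\times n$ square grid on the torus together with markings $X$ and $O$ such that every row and every column contains exactly one $X$ and exactly one $O$, and no square contains both. Number the $O$'s as $O_1,\dots,O_n$. Such a diagram determines an oriented link projection (draw horizontal segments from the $O$'s to the $X$'s in each row and vertical segments from the $X$'s to the $O$'s in each column, the vertical ones passing over). Smoothing its northwest and southeast corners, viewing its southwest and northeast corners as cusps and tilting by $45^\circ$ clockwise gives the front projection of an oriented Legendrian link $\vec{\mathcal L}(G)$, and every oriented Legendrian link $\vec{\mathcal L}$ arises from a grid diagram in this way. Let $\mathbf S(G)$ be the set of one-to-one correspondences between the horizontal and vertical grid circles, regarded as $n$-tuples of intersection points. For $\mathbf x,\mathbf y\in\mathbf S(G)$, let $\mathrm{Rect}(\mathbf x,\mathbf y)$ be the set of rectangles embedded in the torus, with edges on the grid circles, that connect $\mathbf x$ to $\mathbf y$: $\mathbf x$ and $\mathbf y$ agree on all but two vertical circles, the lower left and upper right corners of the rectangle lie in $\mathbf x$, and the lower right and upper left corners lie in $\mathbf y$. Let $\mathrm{Rect}^\circ(\mathbf x,\mathbf y)$ be the subset of those with no point of $\mathbf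 x$ in the interior, and let $O_i(r)\in\{0,1\}$ be the number of times $O_i$ appears in $r$. A sign assignment is a function $\mathcal S$ from these rectangles (for all pairs $\mathbf x,\mathbf y$) to $\{\pm1\}$ such that, on the free $\mathbb Z[U_1,\dots,U_n]$-module $C^-(G)$ generated by $\mathbf S(G)$, the map $$\partial^-_{\mathcal S}(\mathbf x)=\sum_{\mathbf y}\ \sum_{r\in\mathrm{Rect}^\circ(\mathbf x,\mathbf y)}\mathcal S(r)\,U_1^{O_1(r)}\cdots U_n^{O_n(r)}\,\mathbf y$$ satisfies $\partial^-_{\mathcal S}\circ\partial^-_{\mathcal S}=0$, and $H_*\big(C^-(G)/\{U_1=\dots=U_n=1\}\big)\otimes\mathbb Q\neq 0$. Let $\mathit{CL}^-(G)$ be the same module with the differential $\partial$ given by the same sum restricted to those $r$ that contain no $X$, and let $\mathit{HFL}^-=\ker\partial/\operatorname{im}\partial$, a module over $\mathbb Z[U_1,\dots,U_n]$. Let $\mathbf x^+$ (respectively $\mathbf x^-$) be the element of $\mathbf S(G)$ consisting of the upper right (respectively lower left) corners of the squares marked with an $X$. These are cycles in $\mathit{CL}^-(G)$. The Legendrian invariants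 $\lambda^+$ and $\lambda^-$ of $\vec{\mathcal L}(G)$ are the homology classes in $\mathit{HFL}^-$ of $\mathbf z^+=\pm\mathbf x^+$ and $\mathbf z^-=\pm\mathbf x^-$. **Theorem.** Let $\vec{\mathcal L}$ be an oriented Legendrian link, and let $\lambda^+$ and $\lambda^-$ be its Legendrian invariants, computed from any grid diagram $G$ with $\vec{\mathcal L}(G)=\vec{\mathcal L}$, any sign assignment, and any choice of the signs in $\mathbf z^\pm$. Then $\lambda^+\neq0$ and $\lambda^-\neq 0$ in $\mathit{HFL}^-$. Moreover, for every $i\in\{1,\dots,n\}$ neither of them is $U_i$-torsion: for all positive integers $d$, $U_i^d\lambda^+\neq0$ and $U_i^d\lambda^-\neq0$. -/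

import Mathlib

/-- A grid diagram of grid number `n`, drawn on the torus. Columns and rows of unit squares are
indexed by `Fin n`; column `c` lies between the vertical circles `c` and `c + 1` and row `k` lies
between the horizontal circles `k` and `k + 1` (cyclically). The marking `X_c` is the `X` in
column `c`, in row `xRow c`; the marking `O_c` is the `O` in column `c`, in row `oRow c`.
As `xRow` and `oRow` are permutations, each row and each column has exactly one `X` and one `O`;
no square carries both. -/
structure GridDiagram (n : ℕ) where
  xRow : Equiv.Perm (Fin n)
  oRow : Equiv.Perm (Fin n)
  ne : ∀ c, xRow c ≠ oRow c

namespace GridDiagram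

/-- The generators: one-to-one correspondences from the vertical to the horizontal grid circles.
`x c` is the horizontal circle on which the point of `x` on the vertical circle `c` lies. -/
abbrev Gen (n : ℕ) : Type := Equiv.Perm (Fin n)

/-- For `a ≠ b`, `InArc a b c` says that the unit interval from `c` to `c + 1` lies on the arc that
runs from `a` to `b` in the positive direction of the circle with `n` marked points. -/
def InArc {n : ℕ} (a b c : Fin n) : Prop :=
  if a < b then a ≤ c ∧ c < b else a ≤ c ∨ c < b

/-- An embedded rectangle in the torus with edges on the grid circles: it runs from the vertical
circle `left` in the positive direction to the vertical circle `right`, and from the horizontal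
circle `bottom` in the positive direction to the horizontal circle `top`. -/
structure Rectangle (n : ℕ) where
  left : Fin n
  right : Fin n
  bottom : Fin n
  top : Fin n
  left_ne_right : left ≠ right
  bottom_ne_top : bottom ≠ top

namespace Rectangle

variable {n : ℕ}

/-- The unit square in column `c` and row `k` is contained in the rectangle. -/
def ContainsSquare (r : Rectangle n) (c k : Fin n) : Prop :=
  InArc r.left r.right c ∧ InArc r.bottom r.top k

/-- The intersection point of the vertical circle `c` and the horizontal circle `k` lies in the
interior of the rectangle. -/
def InteriorPoint (r : Rectangle n) (c k : Fin n) : Prop :=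
  (InArc r.left r.right c ∧ c ≠ r.left) ∧ (InArc r.bottom r.top k ∧ k ≠ r.bottom)

/-- The rectangle connects `x` to `y`: they agree away from two circles, and the four corners are
points of `x` and `y`, where the lower left and the upper right corner belong to `x` and the
lower right and the upper left corner belong to `y` (so that the horizontal edges, with the
boundary orientation, go from `x` to `y`). -/
def Connects (r : Rectangle n) (x y : Gen n) : Prop :=
  x r.left = r.bottom ∧ x r.right = r.top ∧ y r.right = r.bottom ∧ y r.left = r.top ∧
    ∀ c, c ≠ r.left → c ≠ r.right → x c = y c

/-- No point of `x` lies in the interior of the rectangle. -/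
def IsEmptyFor (r : Rectangle n) (x : Gen n) : Prop :=
  ∀ c, ¬ r.InteriorPoint c (x c)

end Rectangle

/-- The set `Rect(x, y)` of rectangles that connect `x` to `y`. -/
abbrev Rect {n : ℕ} (x y : Gen n) : Type := {r : Rectangle n // r.Connects x y}

instance {n : ℕ} : Finite (Rectangle n) :=
  Finite.of_injective
    (fun r : Rectangle n => (r.left, r.right, r.bottom, r.top))
    (by
      rintro ⟨a, b, c, d, _, _⟩ ⟨a', b', c', d', _, _⟩ h
      simp only [Prod.mk.injEq] at h
      obtain ⟨rfl, rfl, rfl, rfl⟩ := h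
      rfl)

noncomputable instance {n : ℕ} (x y : Gen n) : Fintype (Rect x y) := Fintype.ofFinite _

/-- A choice of a sign for every rectangle connecting two generators. -/
abbrev SignFunction (n : ℕ) : Type := ∀ x y : Gen n, Rect x y → ℤˣ

variable {n : ℕ}

open Classical in
/-- `O_i(r)`: the number of times `O_i` appears in `r`. -/
noncomputable def oCount (G : GridDiagram n) (i : Fin n) (r : Rectangle n) : ℕ :=
  if r.ContainsSquare i (G.oRow i) then 1 else 0

/-- The rectangle contains no `X`. -/
def AvoidsX (G : GridDiagram n) (r : Rectangle n) : Prop :=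
  ∀ c, ¬ r.ContainsSquare c (G.xRow c)

open Classical in
/-- The `R`-linear endomorphism of the free `R`-module on the generators that sends `x` to
`∑_y ∑_r S(r) ∏_i (u i) ^ O_i(r) • y`, where `r` runs over the empty rectangles connecting
`x` to `y` that satisfy `P`. -/
noncomputable def differential {R : Type} [CommRing R] (G : GridDiagram n) (S : SignFunction n)
    (u : Fin n → R) (P : Rectangle n → Prop) : (Gen n →₀ R) →ₗ[R] (Gen n →₀ R) :=
  Finsupp.linearCombination R fun x =>
    ∑ y : Gen n, ∑ r : Rect x y,
      if r.1.IsEmptyFor x ∧ P r.1 then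
        Finsupp.single y (((S x y r : ℤ) : R) * ∏ i, u i ^ G.oCount i r.1)
      else 0

/-- The homology `ker d / im d` of an endomorphism `d` (with `d ∘ d = 0`) of a module. -/
abbrev Homology {R M : Type} [CommRing R] [AddCommGroup M] [Module R M] (d : M →ₗ[R] M) : Type :=
  LinearMap.ker d ⧸ (LinearMap.range d).submoduleOf (LinearMap.ker d)

/-- The ring `ℤ[U_1, …, U_n]`; the variable `U_i` is `MvPolynomial.X i`. -/
abbrev URing (n : ℕ) : Type := MvPolynomial (Fin n) ℤ

/-- The differential of `C⁻(G)`, the free `ℤ[U_1, …, U_n]`-module on the generators: it counts all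
empty rectangles, with signs. -/
noncomputable def dMinus (G : GridDiagram n) (S : SignFunction n) :
    (Gen n →₀ URing n) →ₗ[URing n] (Gen n →₀ URing n) :=
  G.differential S MvPolynomial.X (fun _ => True)

/-- The differential of `C⁻(G) / {U_1 = … = U_n = 1}`, the free `ℤ`-module on the generators. -/
noncomputable def dMinusOne (G : GridDiagram n) (S : SignFunction n) :
    (Gen n →₀ ℤ) →ₗ[ℤ] (Gen n →₀ ℤ) :=
  G.differential S (fun _ => 1) (fun _ => True)

/-- A sign assignment for the grid diagram: a choice of signs that makes `C⁻(G)` a complex and for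
which the homology of `C⁻(G) / {U_1 = … = U_n = 1}` has non-zero rank. -/
structure SignAssignment (G : GridDiagram n) where
  sign : SignFunction n
  sq_zero : G.dMinus sign ∘ₗ G.dMinus sign = 0
  rank_ne_zero : Nontrivial (TensorProduct ℤ ℚ (Homology (G.dMinusOne sign)))

/-- The differential of the link complex `CL⁻(G)` on the same free module: it counts the empty
rectangles that contain no `X`, with signs. -/
noncomputable def dLink (G : GridDiagram n) (S : G.SignAssignment) :
    (Gen n →₀ URing n) →ₗ[URing n] (Gen n →₀ URing n) :=
  G.differential S.sign MvPolynomial.X G.AvoidsX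

/-- The link homology `HFL⁻`, the homology of `CL⁻(G)`, a `ℤ[U_1, …, U_n]`-module. -/
abbrev HFLMinus (G : GridDiagram n) (S : G.SignAssignment) : Type := Homology (G.dLink S)

/-- The generator `x⁺` of the upper right corners `(c + 1, xRow c + 1)` of the squares marked
with an `X`. -/
def xPlus (G : GridDiagram n) : Gen n := finRotate n * G.xRow * (finRotate n)⁻¹

/-- The generator `x⁻` of the lower left corners `(c, xRow c)` of the squares marked
with an `X`. -/
def xMinus (G : GridDiagram n) : Gen n := G.xRow

theorem inArc_left {a b : Fin n} (_ : a ≠ b) : InArc a b a := by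
  unfold InArc
  split_ifs with h'
  · exact ⟨le_rfl, h'⟩
  · exact Or.inl le_rfl

theorem inArc_finRotate {a c : Fin n} (h : a ≠ finRotate n c) : InArc a (finRotate n c) c := by
  obtain _ | m := n
  · exact c.elim0
  · unfold InArc
    rcases eq_or_ne c (Fin.last m) with hc | hc
    · subst hc
      rw [finRotate_last, if_neg (by simp)]
      exact Or.inl (Fin.le_last a)
    · have hv : (finRotate (m + 1) c : ℕ) = c + 1 := coe_finRotate_of_ne_last hc
      simp only [Fin.lt_def, Fin.le_def, hv]
      split_ifs <;> omega

theorem not_avoidsX_of_connects_xPlus (G : GridDiagram n) {y : Gen n} {r : Rectangle n}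
    (h : r.Connects G.xPlus y) : ¬ G.AvoidsX r := by
  intro hr
  obtain ⟨_, ht, _⟩ := h
  obtain ⟨c, hc⟩ := (finRotate n).surjective r.right
  have hk : finRotate n (G.xRow c) = r.top := by
    rw [← ht, ← hc]
    change _ = finRotate n (G.xRow ((finRotate n).symm (finRotate n c)))
    rw [Equiv.symm_apply_apply]
  refine hr c ⟨?_, ?_⟩
  · rw [← hc]
    exact inArc_finRotate (by rw [hc]; exact r.left_ne_right)
  · rw [← hk]
    exact inArc_finRotate (by rw [hk]; exact r.bottom_ne_top)

theorem not_avoidsX_of_connects_xMinus (G : GridDiagram n) {y : Gen n} {r : Rectangle n}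
    (h : r.Connects G.xMinus y) : ¬ G.AvoidsX r := by
  intro hr
  obtain ⟨hb, _⟩ := h
  refine hr r.left ⟨inArc_left r.left_ne_right, ?_⟩
  have : G.xRow r.left = r.bottom := hb
  rw [this]
  exact inArc_left r.bottom_ne_top

theorem dLink_single_eq_zero (G : GridDiagram n) (S : G.SignAssignment) {x : Gen n}
    (h : ∀ (y : Gen n) (r : Rectangle n), r.Connects x y → ¬ G.AvoidsX r) (a : URing n) :
    G.dLink S (Finsupp.single x a) = 0 := by
  unfold dLink differential
  rw [Finsupp.linearCombination_single]
  have : ∀ (y : Gen n) (r : Rect x y), ¬ (r.1.IsEmptyFor x ∧ G.AvoidsX r.1) :=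
    fun y r hr => h y r.1 r.2 hr.2
  simp [this]

/-- The cycle `z⁺ = ± x⁺` of `CL⁻(G)`, with the sign `ε`. -/
noncomputable def zPlus (G : GridDiagram n) (S : G.SignAssignment) (ε : ℤˣ) :
    LinearMap.ker (G.dLink S) :=
  ⟨Finsupp.single G.xPlus ((ε : ℤ) : URing n), LinearMap.mem_ker.mpr
    (G.dLink_single_eq_zero S (fun _ _ => G.not_avoidsX_of_connects_xPlus) _)⟩

/-- The cycle `z⁻ = ± x⁻` of `CL⁻(G)`, with the sign `ε`. -/
noncomputable def zMinus (G : GridDiagram n) (S : G.SignAssignment) (ε : ℤˣ) :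
    LinearMap.ker (G.dLink S) :=
  ⟨Finsupp.single G.xMinus ((ε : ℤ) : URing n), LinearMap.mem_ker.mpr
    (G.dLink_single_eq_zero S (fun _ _ => G.not_avoidsX_of_connects_xMinus) _)⟩

/-- The Legendrian invariant `λ⁺`: the homology class of `z⁺` in `HFL⁻`. -/
noncomputable def lambdaPlus (G : GridDiagram n) (S : G.SignAssignment) (ε : ℤˣ) :
    G.HFLMinus S :=
  Submodule.Quotient.mk (G.zPlus S ε)

/-- The Legendrian invariant `λ⁻`: the homology class of `z⁻` in `HFL⁻`. -/
noncomputable def lambdaMinus (G : GridDiagram n) (S : G.SignAssignment) (ε : ℤˣ) :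
    G.HFLMinus S :=
  Submodule.Quotient.mk (G.zMinus S ε)

/-- A class is `U_i`-torsion if it is annihilated by a positive power of `U_i`. -/
def IsUTorsion (G : GridDiagram n) (S : G.SignAssignment) (i : Fin n) (h : G.HFLMinus S) : Prop :=
  ∃ d : ℕ, 0 < d ∧ (MvPolynomial.X i ^ d : URing n) • h = 0

end GridDiagram

namespace GridDiagram

variable {n : ℕ}

/-! Reduce modulo 2 and set every `U_i = 1`. Signs and weights become 1, so it suffices to find a
`ZMod 2`-valued cocycle for the empty rectangles without `X` that takes the value 1 on the given
generator: it kills boundaries but not `U_i ^ d` times the cycle (`smul_mk_ne_zero`).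

Such a cocycle comes from the larger complex of all empty rectangles. Let `M` be the Maslov grading
defined by the `X`'s; a rectangle lowers it by 1 and raises it by 2 for each `X` it contains. If `φ`
is a cocycle of the full complex with `φ π = 1`, supported in degrees at most `M π`, then its part
in degree `M π` is a cocycle for the rectangles without `X`, since a rectangle with an `X` that
starts in degree `M π + 1` ends above the support (`exists_isLinkCocycle`).

The cocycle `φ` is built by induction on `π`, written as a product of adjacent transpositions
(`hasCocycle`). For `π = 1` the indicator of the identity works. To interchange the markings of
columns `c` and `v = c + 1`, apply `sideSum`, which counts empty rectangles with a side through a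
fixed unit segment of the circle `v`. It maps cocycles to cocycles because it commutes with the
coboundary `rectSum` (`rectSum_sideSum`); the degree count in `HasCocycle.of_mul_swap` controls the
support and the value at `π`.

This treats lower left corners, hence `x⁻`. A half turn of the torus carries `x⁺` to the lower left
corners of the rotated markings. -/

/-- For `a ≠ b`, the marked point `c` lies strictly between `a` and `b` on the arc that runs from
`a` to `b` in the positive direction. -/
def InOpenArc (a b c : Fin n) : Prop := InArc a b c ∧ c ≠ a

instance (a b c : Fin n) : Decidable (InArc a b c) := by unfold InArc; infer_instance

instance (a b c : Fin n) : Decidable (InOpenArc a b c) := by unfold InOpenArc; infer_instance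

/-! ### Cyclic order on a grid circle. -/

section Arcs

variable {a b c d : Fin n}

theorem inArc_iff : InArc a b c ↔
    ((a : ℕ) < b ∧ (a : ℕ) ≤ c ∧ (c : ℕ) < b) ∨ ((b : ℕ) ≤ a ∧ ((a : ℕ) ≤ c ∨ (c : ℕ) < b)) := by
  unfold InArc
  simp only [Fin.lt_def, Fin.le_def]
  split_ifs <;> omega

theorem inOpenArc_iff : InOpenArc a b c ↔
    ((a : ℕ) < c ∧ (c : ℕ) < b) ∨ ((b : ℕ) ≤ a ∧ ((a : ℕ) < c ∨ (c : ℕ) < b)) := by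
  rw [InOpenArc, inArc_iff, Ne, Fin.ext_iff]
  omega

theorem InOpenArc.cycle (hab : a ≠ b) (h : InOpenArc a b c) : InOpenArc b c a := by
  simp only [inOpenArc_iff] at h ⊢
  simp only [Ne, Fin.ext_iff] at hab
  omega

theorem InOpenArc.not_swap (hab : a ≠ b) (h : InOpenArc a b c) : ¬ InOpenArc b a c := by
  simp only [inOpenArc_iff] at h ⊢
  simp only [Ne, Fin.ext_iff] at hab
  omega

theorem InOpenArc.not_swap_right (hab : a ≠ b) (h : InOpenArc a b c) : ¬ InOpenArc a c b := by
  simp only [inOpenArc_iff] at h ⊢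
  simp only [Ne, Fin.ext_iff] at hab
  omega

theorem inOpenArc_total (hbc : b ≠ c) :
    InOpenArc a b c ∨ InOpenArc a c b := by
  rw [inOpenArc_iff, inOpenArc_iff]
  simp only [Ne, Fin.ext_iff] at hbc
  omega

theorem InOpenArc.ne_left (h : InOpenArc a b c) : c ≠ a := h.2

theorem InOpenArc.ne_right (hab : a ≠ b) (h : InOpenArc a b c) : c ≠ b := by
  simp only [inOpenArc_iff] at h ⊢
  simp only [Ne, Fin.ext_iff] at hab
  omega

theorem not_inOpenArc_left : ¬ InOpenArc a b a := fun h => h.2 rfl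

theorem not_inOpenArc_right (hab : a ≠ b) : ¬ InOpenArc a b b := fun h => h.ne_right hab rfl

/-- An arc is the disjoint union of its parts before and after an interior point. -/
theorem InOpenArc.inOpenArc_iff_or (hab : a ≠ b) (h : InOpenArc a b c) (hd : d ≠ c) :
    InOpenArc a b d ↔ InOpenArc a c d ∨ InOpenArc c b d := by
  simp only [inOpenArc_iff] at h ⊢
  simp only [Ne, Fin.ext_iff] at hab hd
  omega

theorem InOpenArc.inArc_iff_or (hab : a ≠ b) (h : InOpenArc a b c) :
    InArc a b d ↔ InArc a c d ∨ InArc c b d := by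
  simp only [inOpenArc_iff, inArc_iff] at h ⊢
  simp only [Ne, Fin.ext_iff] at hab
  omega

theorem InOpenArc.not_inArc_and (hab : a ≠ b) (h : InOpenArc a b c) :
    ¬ (InArc a c d ∧ InArc c b d) := by
  simp only [inOpenArc_iff, inArc_iff] at h ⊢
  simp only [Ne, Fin.ext_iff] at hab
  omega

theorem inArc_swap (hab : a ≠ b) : InArc b a d ↔ ¬ InArc a b d := by
  simp only [inArc_iff]
  simp only [Ne, Fin.ext_iff] at hab
  omega

/-- An arc that starts inside the arc from `a` to `b` and ends outside of it passes through `b`. -/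
theorem InOpenArc.exit (hcd : c ≠ d) (hdb : d ≠ b) (h : InOpenArc a b c) (hd : ¬ InOpenArc a b d) :
    InOpenArc c d b := by
  simp only [inOpenArc_iff] at h hd ⊢
  simp only [Ne, Fin.ext_iff] at hcd hdb
  omega

/-- An arc that starts outside the arc from `a` to `b` and ends inside of it passes through `a`. -/
theorem InOpenArc.enter (hcd : c ≠ d) (hca : c ≠ a) (h : InOpenArc a b d)
    (hc : ¬ InOpenArc a b c) : InOpenArc c d a := by
  simp only [inOpenArc_iff] at h hc ⊢
  simp only [Ne, Fin.ext_iff] at hcd hca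
  omega

end Arcs

/-! ### Empty rectangles from a generator and their compositions. -/

/-- The rectangle with left side on the vertical circle `l` and right side on the vertical circle
`r` that leaves the generator `x` exists and is empty. -/
def EmptyFrom (x : Gen n) (l r : Fin n) : Prop :=
  l ≠ r ∧ ∀ c, ¬ (InOpenArc l r c ∧ InOpenArc (x l) (x r) (x c))

instance (x : Gen n) (l r : Fin n) : Decidable (EmptyFrom x l r) := by
  unfold EmptyFrom; infer_instance

/-- The rectangle from `x` between the vertical circles `l` and `r` has a vertical side
on the circle `v` that covers the unit interval starting at height `k`. -/
def HasSide (v k : Fin n) (x : Gen n) (l r : Fin n) : Prop :=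
  (l = v ∨ r = v) ∧ InArc (x l) (x r) k

instance (v k : Fin n) (x : Gen n) (l r : Fin n) : Decidable (HasSide v k x l r) := by
  unfold HasSide; infer_instance

/-- The circle `m` is singled out because, for compositions over three circles, its point is the
only one that needs separate treatment. -/
theorem emptyFrom_iff {x : Gen n} {l r m : Fin n} (hlr : l ≠ r) :
    EmptyFrom x l r ↔ ¬ (InOpenArc l r m ∧ InOpenArc (x l) (x r) (x m)) ∧
      ∀ c, c ≠ l → c ≠ r → c ≠ m → ¬ (InOpenArc l r c ∧ InOpenArc (x l) (x r) (x c)) := by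
  constructor
  · rintro ⟨-, h⟩
    exact ⟨h m, fun c _ _ _ => h c⟩
  · rintro ⟨h, h'⟩
    refine ⟨hlr, fun c hc => ?_⟩
    by_cases hm : c = m
    · subst hm; exact h hc
    · exact h' c hc.1.ne_left (hc.1.ne_right hlr) hm hc

/-- The sum of the values of `φ` at the ends of all empty rectangles from `x`. -/
def rectSum (φ : Gen n → ZMod 2) (x : Gen n) : ZMod 2 :=
  ∑ l, ∑ r, if EmptyFrom x l r then φ (x * Equiv.swap l r) else 0

/-- The sum of the values of `φ` at the ends of the empty rectangles from `x` that have a vertical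
side on the circle `v` covering the unit interval at height `k`. -/
def sideSum (v k : Fin n) (φ : Gen n → ZMod 2) (x : Gen n) : ZMod 2 :=
  ∑ l, ∑ r, if EmptyFrom x l r ∧ HasSide v k x l r then φ (x * Equiv.swap l r) else 0

/-- The contribution to the commutator of `rectSum` and `sideSum` of the composition of the
rectangle from `x` between the circles `l` and `r` with a rectangle between `l'` and `r'`. -/
def pairTerm (v k : Fin n) (φ : Gen n → ZMod 2) (x : Gen n) (l r l' r' : Fin n) : ZMod 2 :=
  if EmptyFrom x l r ∧ EmptyFrom (x * Equiv.swap l r) l' r' then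
    ((if HasSide v k x l r then 1 else 0) +
      (if HasSide v k (x * Equiv.swap l r) l' r' then 1 else 0)) *
      φ (x * Equiv.swap l r * Equiv.swap l' r')
  else 0

theorem pairTerm_congr {v k : Fin n} {φ : Gen n → ZMod 2} {x : Gen n}
    {l r l' r' p q p' q' : Fin n}
    (hE : EmptyFrom x l r ∧ EmptyFrom (x * Equiv.swap l r) l' r' ↔
      EmptyFrom x p q ∧ EmptyFrom (x * Equiv.swap p q) p' q')
    (hS : ((if HasSide v k x l r then 1 else 0) +
      (if HasSide v k (x * Equiv.swap l r) l' r' then 1 else 0) : ZMod 2) =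
      (if HasSide v k x p q then 1 else 0) +
      (if HasSide v k (x * Equiv.swap p q) p' q' then 1 else 0))
    (hx : Equiv.swap l r * Equiv.swap l' r' = Equiv.swap p q * Equiv.swap p' q') :
    pairTerm v k φ x l r l' r' = pairTerm v k φ x p q p' q' := by
  unfold pairTerm
  rw [mul_assoc, mul_assoc, hx, hS]
  exact if_congr hE rfl rfl

/-- Both composites run over pairs of successive empty rectangles; one requires the side of the
second rectangle, the other that of the first. A pair is therefore weighted by how many of its
rectangles have the side. -/
theorem rectSum_sideSum_add (v k : Fin n) (φ : Gen n → ZMod 2) (x : Gen n) :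
    rectSum (sideSum v k φ) x + sideSum v k (rectSum φ) x =
      ∑ l, ∑ r, ∑ l', ∑ r', pairTerm v k φ x l r l' r' := by
  unfold rectSum sideSum
  rw [← Finset.sum_add_distrib]
  refine Finset.sum_congr rfl fun l _ => ?_
  rw [← Finset.sum_add_distrib]
  refine Finset.sum_congr rfl fun r _ => ?_
  unfold pairTerm
  by_cases h : EmptyFrom x l r
  · by_cases hs : HasSide v k x l r
    · simp only [h, hs, true_and, if_true, and_self]
      rw [← Finset.sum_add_distrib]
      refine Finset.sum_congr rfl fun l' _ => ?_
      rw [← Finset.sum_add_distrib]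
      refine Finset.sum_congr rfl fun r' _ => ?_
      split_ifs <;> (simp_all; try ring)
    · simp only [h, hs, true_and, if_true, if_false, and_false, add_zero, zero_add]
      refine Finset.sum_congr rfl fun l' _ => Finset.sum_congr rfl fun r' _ => ?_
      split_ifs <;> simp_all
  · simp [h]

theorem swap_mul_swap_eq {a b c : Fin n} (hac : a ≠ c) (hbc : b ≠ c) :
    Equiv.swap a b * Equiv.swap b c = Equiv.swap a c * Equiv.swap a b := by
  rw [Equiv.mul_swap_eq_swap_mul, Equiv.swap_apply_right,
    Equiv.swap_apply_of_ne_of_ne hac.symm hbc.symm]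

theorem swap_mul_swap_eq' {a b c : Fin n} (hab : a ≠ b) (hac : a ≠ c) :
    Equiv.swap a b * Equiv.swap b c = Equiv.swap b c * Equiv.swap a c := by
  rw [Equiv.mul_swap_eq_swap_mul (Equiv.swap b c), Equiv.swap_apply_right,
    Equiv.swap_apply_of_ne_of_ne hab hac]

theorem ite_hasSide {v k : Fin n} {x : Gen n} {l r : Fin n} (h : l ≠ r) :
    (if HasSide v k x l r then 1 else 0 : ZMod 2) =
      ((if l = v then 1 else 0) + (if r = v then 1 else 0)) *
        (if InArc (x l) (x r) k then 1 else 0) := by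
  by_cases hl : l = v
  · simp [HasSide, hl, (hl ▸ h).symm]
  · by_cases hr : r = v <;> simp [HasSide, hl, hr]

theorem InOpenArc.ite_inArc {a b c d : Fin n} (hab : a ≠ b) (h : InOpenArc a b c) :
    (if InArc a b d then 1 else 0 : ZMod 2) =
      (if InArc a c d then 1 else 0) + (if InArc c b d then 1 else 0) := by
  have h' := h.not_inArc_and (d := d) hab
  rw [if_congr (h.inArc_iff_or (d := d) hab) rfl rfl]
  by_cases h1 : InArc a c d
  · have h2 : ¬ InArc c b d := fun h2 => h' ⟨h1, h2⟩
    simp [h1, h2]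
  · simp [h1]

/-! ### L-shaped domains over three vertical circles. -/

section Triple

variable {v k : Fin n} {φ : Gen n → ZMod 2} {x : Gen n} {p q w : Fin n}

/-- If `q` lies between `p` and `w` and the points of `x` on these circles are in the same cyclic
order, the L-shaped domain of the rectangles over `p, q` and `q, w` is cut in two ways. -/
theorem pairTerm_eq_of_increasing (hpq : p ≠ q) (hqw : q ≠ w) (hpw : p ≠ w) (hc : InOpenArc p w q)
    (hr : InOpenArc (x p) (x w) (x q)) :
    pairTerm v k φ x p q q w = pairTerm v k φ x q w p w := by
  have hpq' : x p ≠ x q := x.injective.ne hpq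
  have hqw' : x q ≠ x w := x.injective.ne hqw
  have hpw' : x p ≠ x w := x.injective.ne hpw
  have c2 := hc.cycle hpw
  have c3 := c2.cycle hqw.symm
  have c4 := hc.not_swap_right hpw
  have c6 := c3.not_swap_right hpq.symm
  have r2 := hr.cycle hpw'
  have r3 := r2.cycle hqw'.symm
  have r4 := hr.not_swap_right hpw'
  have r6 := r3.not_swap_right hpq'.symm
  have hs1 := Equiv.swap_apply_of_ne_of_ne hpq hpw
  have hs3 := Equiv.swap_apply_of_ne_of_ne hpw.symm hqw.symm
  apply pairTerm_congr
  · rw [emptyFrom_iff (m := w) hpq, emptyFrom_iff (m := p) hqw, emptyFrom_iff (m := p) hqw,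
      emptyFrom_iff (m := q) hpw]
    simp only [Equiv.Perm.mul_apply, Equiv.swap_apply_left, Equiv.swap_apply_right, hs1, hs3,
      c4, c6, r4, r6, false_and, and_false, not_false_eq_true, true_and]
    rw [← forall_and, ← forall_and]
    refine forall_congr' fun c => ?_
    by_cases e1 : c = p
    · simp [e1]
    by_cases e2 : c = q
    · simp [e2]
    by_cases e3 : c = w
    · simp [e3]
    rw [Equiv.swap_apply_of_ne_of_ne e1 e2, Equiv.swap_apply_of_ne_of_ne e2 e3,
      hc.inOpenArc_iff_or hpw e2, hr.inOpenArc_iff_or hpw' (x.injective.ne e2)]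
    grind
  · rw [ite_hasSide hpq, ite_hasSide hqw, ite_hasSide hqw, ite_hasSide hpw]
    simp only [Equiv.Perm.mul_apply, Equiv.swap_apply_right, hs1, hs3]
    rw [hr.ite_inArc hpw']
    generalize (if p = v then 1 else 0 : ZMod 2) = P, (if q = v then 1 else 0 : ZMod 2) = Q,
      (if w = v then 1 else 0 : ZMod 2) = W, (if InArc (x p) (x q) k then 1 else 0 : ZMod 2) = K0,
      (if InArc (x q) (x w) k then 1 else 0 : ZMod 2) = K1
    -- The vertical cut along `q` is a side of both rectangles, so it contributes twice; the
    -- horizontal cut contributes no vertical side.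
    linear_combination (Q * K0) * (CharTwo.two_eq_zero : (2 : ZMod 2) = 0)
  · exact swap_mul_swap_eq' hpq hpw

/-- The L-shaped domain of the rectangles over `q, w` and `p, q`, in the same cyclic order. -/
theorem pairTerm_eq_of_increasing' (hpq : p ≠ q) (hqw : q ≠ w) (hpw : p ≠ w) (hc : InOpenArc p w q)
    (hr : InOpenArc (x p) (x w) (x q)) :
    pairTerm v k φ x q w p q = pairTerm v k φ x p q p w := by
  have hpq' : x p ≠ x q := x.injective.ne hpq
  have hqw' : x q ≠ x w := x.injective.ne hqw
  have hpw' : x p ≠ x w := x.injective.ne hpw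
  have c2 := hc.cycle hpw
  have c3 := c2.cycle hqw.symm
  have c4 := hc.not_swap_right hpw
  have c6 := c3.not_swap_right hpq.symm
  have r2 := hr.cycle hpw'
  have r3 := r2.cycle hqw'.symm
  have r4 := hr.not_swap_right hpw'
  have r6 := r3.not_swap_right hpq'.symm
  have hs1 := Equiv.swap_apply_of_ne_of_ne hpq hpw
  have hs3 := Equiv.swap_apply_of_ne_of_ne hpw.symm hqw.symm
  apply pairTerm_congr
  · rw [emptyFrom_iff (m := p) hqw, emptyFrom_iff (m := w) hpq, emptyFrom_iff (m := w) hpq,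
      emptyFrom_iff (m := q) hpw]
    simp only [Equiv.Perm.mul_apply, Equiv.swap_apply_left, Equiv.swap_apply_right, hs1, hs3,
      c4, c6, r4, r6, false_and, and_false, not_false_eq_true, true_and]
    rw [← forall_and, ← forall_and]
    refine forall_congr' fun c => ?_
    by_cases e1 : c = p
    · simp [e1]
    by_cases e2 : c = q
    · simp [e2]
    by_cases e3 : c = w
    · simp [e3]
    rw [Equiv.swap_apply_of_ne_of_ne e2 e3, Equiv.swap_apply_of_ne_of_ne e1 e2,
      hc.inOpenArc_iff_or hpw e2, hr.inOpenArc_iff_or hpw' (x.injective.ne e2)]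
    grind
  · rw [ite_hasSide hqw, ite_hasSide hpq, ite_hasSide hpq, ite_hasSide hpw]
    simp only [Equiv.Perm.mul_apply, Equiv.swap_apply_left, hs1, hs3]
    rw [hr.ite_inArc hpw']
    generalize (if p = v then 1 else 0 : ZMod 2) = P, (if q = v then 1 else 0 : ZMod 2) = Q,
      (if w = v then 1 else 0 : ZMod 2) = W, (if InArc (x p) (x q) k then 1 else 0 : ZMod 2) = K0,
      (if InArc (x q) (x w) k then 1 else 0 : ZMod 2) = K1
    linear_combination (Q * K1) * (CharTwo.two_eq_zero : (2 : ZMod 2) = 0)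
  · rw [Equiv.swap_comm q w, Equiv.swap_comm p q, swap_mul_swap_eq' hqw.symm hpw.symm,
      Equiv.swap_comm w p]

/-- The L-shaped domain of the rectangles over `p, q` and `q, w`, in the opposite cyclic order. -/
theorem pairTerm_eq_of_decreasing (hpq : p ≠ q) (hqw : q ≠ w) (hpw : p ≠ w) (hc : InOpenArc p w q)
    (hr : InOpenArc (x p) (x q) (x w)) :
    pairTerm v k φ x p q q w = pairTerm v k φ x p w p q := by
  have hpq' : x p ≠ x q := x.injective.ne hpq
  have hqw' : x q ≠ x w := x.injective.ne hqw
  have hpw' : x p ≠ x w := x.injective.ne hpw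
  have c2 := hc.cycle hpw
  have c3 := c2.cycle hqw.symm
  have c4 := hc.not_swap_right hpw
  have c6 := c3.not_swap_right hpq.symm
  have r2 := hr.cycle hpq'
  have r3 := r2.cycle hqw'
  have r4 := hr.not_swap_right hpq'
  have r6 := r3.not_swap_right hpw'.symm
  have hs2 := Equiv.swap_apply_of_ne_of_ne hpq.symm hqw
  have hs3 := Equiv.swap_apply_of_ne_of_ne hpw.symm hqw.symm
  apply pairTerm_congr
  · rw [emptyFrom_iff (m := w) hpq, emptyFrom_iff (m := p) hqw, emptyFrom_iff (m := q) hpw,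
      emptyFrom_iff (m := w) hpq]
    simp only [Equiv.Perm.mul_apply, Equiv.swap_apply_left, Equiv.swap_apply_right, hs2, hs3,
      c4, c6, r4, r6, false_and, and_false, not_false_eq_true, true_and]
    rw [← forall_and, ← forall_and]
    refine forall_congr' fun c => ?_
    by_cases e1 : c = p
    · simp [e1]
    by_cases e2 : c = q
    · simp [e2]
    by_cases e3 : c = w
    · simp [e3]
    rw [Equiv.swap_apply_of_ne_of_ne e1 e2, Equiv.swap_apply_of_ne_of_ne e1 e3,
      hc.inOpenArc_iff_or hpw e2, hr.inOpenArc_iff_or hpq' (x.injective.ne e3)]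
    grind
  · rw [ite_hasSide hpq, ite_hasSide hqw, ite_hasSide hpw, ite_hasSide hpq]
    simp only [Equiv.Perm.mul_apply, Equiv.swap_apply_left, Equiv.swap_apply_right, hs2, hs3]
    rw [hr.ite_inArc hpq']
    generalize (if p = v then 1 else 0 : ZMod 2) = P, (if q = v then 1 else 0 : ZMod 2) = Q,
      (if w = v then 1 else 0 : ZMod 2) = W, (if InArc (x p) (x w) k then 1 else 0 : ZMod 2) = K0,
      (if InArc (x w) (x q) k then 1 else 0 : ZMod 2) = K1
    linear_combination (Q * K0) * (CharTwo.two_eq_zero : (2 : ZMod 2) = 0)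
  · exact swap_mul_swap_eq hpw hqw

/-- The L-shaped domain of the rectangles over `q, w` and `p, q`, in the opposite cyclic order. -/
theorem pairTerm_eq_of_decreasing' (hpq : p ≠ q) (hqw : q ≠ w) (hpw : p ≠ w) (hc : InOpenArc p w q)
    (hr : InOpenArc (x p) (x q) (x w)) :
    pairTerm v k φ x q w p q = pairTerm v k φ x p w q w := by
  have hpq' : x p ≠ x q := x.injective.ne hpq
  have hqw' : x q ≠ x w := x.injective.ne hqw
  have hpw' : x p ≠ x w := x.injective.ne hpw
  have c2 := hc.cycle hpw
  have c3 := c2.cycle hqw.symm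
  have c4 := hc.not_swap_right hpw
  have c6 := c3.not_swap_right hpq.symm
  have r2 := hr.cycle hpq'
  have r4 := hr.not_swap_right hpq'
  have r5 := r2.not_swap_right hqw'
  have hs1 := Equiv.swap_apply_of_ne_of_ne hpq hpw
  have hs2 := Equiv.swap_apply_of_ne_of_ne hpq.symm hqw
  apply pairTerm_congr
  · rw [emptyFrom_iff (m := p) hqw, emptyFrom_iff (m := w) hpq, emptyFrom_iff (m := q) hpw,
      emptyFrom_iff (m := p) hqw]
    simp only [Equiv.Perm.mul_apply, Equiv.swap_apply_left, Equiv.swap_apply_right, hs1, hs2,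
      c4, c6, r4, r5, false_and, and_false, not_false_eq_true, true_and]
    rw [← forall_and, ← forall_and]
    refine forall_congr' fun c => ?_
    by_cases e1 : c = p
    · simp [e1]
    by_cases e2 : c = q
    · simp [e2]
    by_cases e3 : c = w
    · simp [e3]
    rw [Equiv.swap_apply_of_ne_of_ne e2 e3, Equiv.swap_apply_of_ne_of_ne e1 e3,
      hc.inOpenArc_iff_or hpw e2, r2.inOpenArc_iff_or hqw' (x.injective.ne e1)]
    grind
  · rw [ite_hasSide hqw, ite_hasSide hpq, ite_hasSide hpw, ite_hasSide hqw]
    simp only [Equiv.Perm.mul_apply, Equiv.swap_apply_left, Equiv.swap_apply_right, hs1, hs2]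
    rw [r2.ite_inArc hqw']
    generalize (if p = v then 1 else 0 : ZMod 2) = P, (if q = v then 1 else 0 : ZMod 2) = Q,
      (if w = v then 1 else 0 : ZMod 2) = W, (if InArc (x q) (x p) k then 1 else 0 : ZMod 2) = K0,
      (if InArc (x p) (x w) k then 1 else 0 : ZMod 2) = K1
    linear_combination (Q * K1) * (CharTwo.two_eq_zero : (2 : ZMod 2) = 0)
  · rw [Equiv.swap_comm q w, Equiv.swap_comm p q, swap_mul_swap_eq hpw.symm hpq.symm,
      Equiv.swap_comm w p]

end Triple

/-! ### Cancellation among the compositions of two rectangles. -/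

section Pairs

variable {v k : Fin n} {φ : Gen n → ZMod 2} {x : Gen n}

theorem pairTerm_eq_zero {l r l' r' : Fin n}
    (h : EmptyFrom x l r → ¬ EmptyFrom (x * Equiv.swap l r) l' r') :
    pairTerm v k φ x l r l' r' = 0 :=
  if_neg fun h' => h h'.1 h'.2

/-- Three circles in the cyclic order `p`, `q`, `w`. -/
def IsCyclic (p q w : Fin n) : Prop := p ≠ w ∧ InOpenArc p w q

instance (p q w : Fin n) : Decidable (IsCyclic p q w) := by unfold IsCyclic; infer_instance

namespace IsCyclic

variable {p q w : Fin n}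

theorem ne_left (h : IsCyclic p q w) : p ≠ q := h.2.ne_left.symm

theorem ne_right (h : IsCyclic p q w) : q ≠ w := h.2.ne_right h.1

theorem rotate (h : IsCyclic p q w) : IsCyclic q w p := by
  have h1 := h.2.cycle h.1
  exact ⟨h.ne_left.symm, h1.cycle h.ne_right.symm⟩

theorem total (hpq : p ≠ q) (hqw : q ≠ w) (hpw : p ≠ w) : IsCyclic p q w ∨ IsCyclic p w q := by
  rcases inOpenArc_total (a := p) hqw with h | h
  · exact Or.inr ⟨hpq, h⟩
  · exact Or.inl ⟨hpw, h⟩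

theorem not_swap (h : IsCyclic p q w) : ¬ IsCyclic p w q := fun h' =>
  h.2.not_swap_right h.1 h'.2

end IsCyclic

theorem EmptyFrom.not_isCyclic {l r c : Fin n} (h : EmptyFrom x l r) (hc : IsCyclic l c r) :
    ¬ IsCyclic (x l) (x c) (x r) := fun h' => h.2 c ⟨hc.2, h'.2⟩

theorem EmptyFrom.isCyclic {l r c : Fin n} (h : EmptyFrom x l r) (hc : IsCyclic l c r) :
    IsCyclic (x l) (x r) (x c) :=
  (IsCyclic.total (x.injective.ne hc.1) (x.injective.ne hc.ne_right.symm)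
    (x.injective.ne hc.ne_left)).resolve_right (h.not_isCyclic hc)

/-- A domain over three vertical circles has exactly two decompositions, which have the same
total side. -/
theorem pairTerm_sum_isCyclic {p q w : Fin n} (hc : IsCyclic p q w) :
    pairTerm v k φ x p q q w + pairTerm v k φ x q w p q + pairTerm v k φ x p w p q +
      pairTerm v k φ x p q p w + pairTerm v k φ x q w p w + pairTerm v k φ x p w q w = 0 := by
  have hpq := hc.ne_left
  have hqw := hc.ne_right
  have hpw := hc.1
  have hs1 := Equiv.swap_apply_of_ne_of_ne hpq hpw
  have hs2 := Equiv.swap_apply_of_ne_of_ne hpq.symm hqw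
  have hs3 := Equiv.swap_apply_of_ne_of_ne hpw.symm hqw.symm
  rcases IsCyclic.total (x.injective.ne hpq) (x.injective.ne hqw) (x.injective.ne hpw) with hr | hr
  · rw [pairTerm_eq_of_increasing hpq hqw hpw hc.2 hr.2,
      pairTerm_eq_of_increasing' hpq hqw hpw hc.2 hr.2,
      pairTerm_eq_zero (l := p) (r := w) (l' := p) (r' := q) fun h => absurd hr (h.not_isCyclic hc),
      pairTerm_eq_zero (l := p) (r := w) (l' := q) (r' := w) fun h => absurd hr (h.not_isCyclic hc)]
    linear_combination (pairTerm v k φ x q w p w + pairTerm v k φ x p q p w) *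
      (CharTwo.two_eq_zero : (2 : ZMod 2) = 0)
  · rw [pairTerm_eq_of_decreasing hpq hqw hpw hc.2 hr.2,
      pairTerm_eq_of_decreasing' hpq hqw hpw hc.2 hr.2,
      pairTerm_eq_zero (l := p) (r := q) (l' := p) (r' := w) fun _ h => h.not_isCyclic hc (by
        simpa [hs3] using hr.rotate.rotate),
      pairTerm_eq_zero (l := q) (r := w) (l' := p) (r' := w) fun _ h => h.not_isCyclic hc (by
        simpa [hs1] using hr)]
    linear_combination (pairTerm v k φ x p w p q + pairTerm v k φ x p w q w) *
      (CharTwo.two_eq_zero : (2 : ZMod 2) = 0)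

/-- The two horizontal arcs overlap and wrap around the torus. Emptiness of the first rectangle
fixes the cyclic order of the three heights, which puts the point on `p` inside the second. -/
theorem pairTerm_eq_zero_of_isCyclic {p q w : Fin n} (hc : IsCyclic p w q) :
    pairTerm v k φ x p q q w = 0 := by
  refine pairTerm_eq_zero fun h h' => h'.not_isCyclic hc.rotate.rotate ?_
  have := (h.isCyclic hc)
  simpa [Equiv.swap_apply_of_ne_of_ne hc.ne_left.symm hc.ne_right] using this

theorem pairTerm_eq_zero_of_isCyclic' {p q w : Fin n} (hc : IsCyclic p w q) :
    pairTerm v k φ x q w p q = 0 := by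
  refine pairTerm_eq_zero fun h h' => h'.not_isCyclic hc ?_
  have := (h.isCyclic hc.rotate.rotate).rotate.rotate
  simpa [Equiv.swap_apply_of_ne_of_ne hc.1 hc.ne_left] using this

/-- The only danger is a corner of one rectangle inside the other. Emptiness in the old order keeps
the adjacent corners out, so both arcs exit or enter, and a corner would already lie inside a
rectangle in the old order. -/
theorem emptyFrom_comm {l r l' r' : Fin n} (h₁ : l' ≠ l) (h₂ : l' ≠ r) (h₃ : r' ≠ l)
    (h₄ : r' ≠ r) (h : EmptyFrom x l r ∧ EmptyFrom (x * Equiv.swap l r) l' r') :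
    EmptyFrom x l' r' ∧ EmptyFrom (x * Equiv.swap l' r') l r := by
  obtain ⟨⟨hlr, h⟩, hlr', h'⟩ := h
  have i := x.injective
  simp only [Equiv.Perm.mul_apply, Equiv.swap_apply_of_ne_of_ne h₁ h₂,
    Equiv.swap_apply_of_ne_of_ne h₃ h₄] at h'
  have hl := h' l
  have hr := h' r
  rw [Equiv.swap_apply_left] at hl
  rw [Equiv.swap_apply_right] at hr
  have gl := h l'
  have gr := h r'
  refine ⟨⟨hlr', fun c hc => ?_⟩, hlr, fun c hc => ?_⟩
  · by_cases e1 : c = l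
    · subst e1
      have e2 : ¬ InOpenArc l' r' r := fun e => hr ⟨e, hc.2⟩
      have e3 : ¬ InOpenArc (x l') (x r') (x r) := fun e => hl ⟨hc.1, e⟩
      exact gr ⟨hc.1.exit hlr h₄.symm e2, hc.2.exit (i.ne hlr) (i.ne h₄.symm) e3⟩
    by_cases e2 : c = r
    · subst e2
      have e2 : ¬ InOpenArc l' r' l := fun e => hl ⟨e, hc.2⟩
      have e3 : ¬ InOpenArc (x l') (x r') (x l) := fun e => hr ⟨hc.1, e⟩
      exact gl ⟨hc.1.enter hlr h₁.symm e2, hc.2.enter (i.ne hlr) (i.ne h₁.symm) e3⟩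
    have := h' c
    rw [Equiv.swap_apply_of_ne_of_ne e1 e2] at this
    exact this hc
  · simp only [Equiv.Perm.mul_apply, Equiv.swap_apply_of_ne_of_ne h₁.symm h₃.symm,
      Equiv.swap_apply_of_ne_of_ne h₂.symm h₄.symm] at hc
    by_cases e1 : c = l'
    · subst e1
      rw [Equiv.swap_apply_left] at hc
      have e2 : ¬ InOpenArc l r r' := fun e => gr ⟨e, hc.2⟩
      have e3 : ¬ InOpenArc (x l) (x r) (x c) := fun e => gl ⟨hc.1, e⟩
      exact hr ⟨hc.1.exit hlr' h₄ e2, hc.2.enter (i.ne hlr') (i.ne h₁) e3⟩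
    by_cases e2 : c = r'
    · subst e2
      rw [Equiv.swap_apply_right] at hc
      have e2 : ¬ InOpenArc l r l' := fun e => gl ⟨e, hc.2⟩
      have e3 : ¬ InOpenArc (x l) (x r) (x c) := fun e => gr ⟨hc.1, e⟩
      exact hl ⟨hc.1.enter hlr' h₁ e2, hc.2.exit (i.ne hlr') (i.ne h₄) e3⟩
    rw [Equiv.swap_apply_of_ne_of_ne e1 e2] at hc
    exact h c hc

theorem pairTerm_comm {l r l' r' : Fin n} (h₁ : l' ≠ l) (h₂ : l' ≠ r) (h₃ : r' ≠ l)
    (h₄ : r' ≠ r) : pairTerm v k φ x l r l' r' = pairTerm v k φ x l' r' l r := by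
  refine pairTerm_congr ⟨emptyFrom_comm h₁ h₂ h₃ h₄,
    emptyFrom_comm h₁.symm h₃.symm h₂.symm h₄.symm⟩ ?_ ?_
  · simp only [HasSide, Equiv.Perm.mul_apply, Equiv.swap_apply_of_ne_of_ne h₁ h₂,
      Equiv.swap_apply_of_ne_of_ne h₃ h₄, Equiv.swap_apply_of_ne_of_ne h₁.symm h₃.symm,
      Equiv.swap_apply_of_ne_of_ne h₂.symm h₄.symm]
    exact add_comm _ _
  · rw [Equiv.mul_swap_eq_swap_mul, Equiv.swap_apply_of_ne_of_ne h₁ h₂,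
      Equiv.swap_apply_of_ne_of_ne h₃ h₄]

/-- The two rectangles of a horizontal annulus have the same sides. -/
theorem pairTerm_horizontal (l r : Fin n) : pairTerm v k φ x l r r l = 0 := by
  have h : HasSide v k (x * Equiv.swap l r) r l ↔ HasSide v k x l r := by
    simp [HasSide, or_comm]
  simp [pairTerm, h, CharTwo.add_self_eq_zero]

theorem forall_not_inOpenArc_iff {l r : Fin n} (h : l ≠ r) :
    (∀ c, ¬ InOpenArc l r c) ↔ r = finRotate n l := by
  constructor
  · intro hlr
    obtain ⟨c, rfl⟩ := (finRotate n).surjective r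
    by_contra hc
    exact hlr c ⟨inArc_finRotate h, fun e => hc (e ▸ rfl)⟩
  · rintro rfl c hc
    obtain _ | m := n
    · exact c.elim0
    rw [inOpenArc_iff] at hc
    rcases eq_or_ne l (Fin.last m) with hl | hl
    · subst hl
      rw [finRotate_last, Fin.val_zero, Fin.val_last] at hc
      have := c.isLt
      omega
    · rw [coe_finRotate_of_ne_last hl] at hc
      omega

/-- The two rectangles fill a vertical annulus. A point of `x` on a circle strictly inside it would
lie in one of them, so the annulus has width one. Its two height arcs are complementary, so each
boundary circle is covered exactly once at height `k`. -/
theorem pairTerm_vertical (l r : Fin n) : pairTerm v k φ x l r l r =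
    if r = finRotate n l then
      (if l ≠ r then (if l = v then φ x else 0) + (if r = v then φ x else 0) else 0) else 0 := by
  by_cases hlr : l = r
  · rw [pairTerm_eq_zero fun h => absurd hlr h.1]
    simp [hlr]
  have hx : x l ≠ x r := x.injective.ne hlr
  have hE : EmptyFrom x l r ∧ EmptyFrom (x * Equiv.swap l r) l r ↔ r = finRotate n l := by
    rw [← forall_not_inOpenArc_iff hlr]
    constructor
    · rintro ⟨⟨-, h⟩, -, h'⟩ c hc
      have h2 := h' c
      have e1 := hc.ne_left
      have e2 := hc.ne_right hlr
      simp only [Equiv.Perm.mul_apply, Equiv.swap_apply_left, Equiv.swap_apply_right,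
        Equiv.swap_apply_of_ne_of_ne e1 e2] at h2
      rcases IsCyclic.total hx (x.injective.ne e2.symm) (x.injective.ne e1.symm) with e | e
      · exact h2 ⟨hc, e.rotate.2⟩
      · exact h c ⟨hc, e.2⟩
    · exact fun h => ⟨⟨hlr, fun c hc => h c hc.1⟩, hlr, fun c hc => h c hc.1⟩
  unfold pairTerm
  rw [if_congr hE rfl rfl, mul_assoc, Equiv.swap_mul_self, mul_one]
  refine if_congr Iff.rfl ?_ rfl
  rw [if_pos hlr, ite_hasSide hlr, ite_hasSide hlr]
  simp only [Equiv.Perm.mul_apply, Equiv.swap_apply_left, Equiv.swap_apply_right,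
    if_congr (inArc_swap (d := k) hx) rfl rfl]
  by_cases e : InArc (x l) (x r) k <;> simp [e, add_mul]

/-- Exactly two annuli of width one border the circle `v`, one on each side, and they cancel modulo
2. -/
theorem sum_pairTerm_vertical : ∑ l, ∑ r, pairTerm v k φ x l r l r = 0 := by
  simp only [pairTerm_vertical, Finset.sum_ite_eq', Finset.mem_univ, if_true]
  -- A fixed point of the rotation forces `n = 1`, where no two circles are distinct.
  by_cases h : ∃ l, l = finRotate n l
  · have hn : ∀ l : Fin n, l = finRotate n l := by
      obtain ⟨l, hl⟩ := h
      obtain _ | _ | m := n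
      · exact l.elim0
      · exact fun l' => Fin.ext (by omega)
      · exfalso
        rw [finRotate_apply, eq_comm] at hl
        simp at hl
    refine Finset.sum_eq_zero fun l _ => ?_
    rw [if_neg (not_not.2 (hn l))]
  · push Not at h
    simp only [ne_eq, h, not_false_eq_true, if_true, Finset.sum_add_distrib, Finset.sum_ite_eq',
      Finset.mem_univ]
    rw [Equiv.sum_comp (finRotate n) fun r => if r = v then φ x else 0]
    simp [CharTwo.add_self_eq_zero]

end Pairs

theorem sum_eq_zero_of_symm {ι : Type*} [Fintype ι] (f : ι → ι → ZMod 2)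
    (hs : ∀ a b, f a b = f b a) (h0 : ∀ a, f a a = 0) : ∑ a, ∑ b, f a b = 0 := by
  classical
  rw [← Fintype.sum_prod_type' f]
  refine Finset.sum_involution (fun a _ => a.swap) (fun a _ => ?_) (fun a _ ha h => ?_)
    (fun _ _ => Finset.mem_univ _) fun a _ => Prod.swap_swap a
  · rw [Prod.fst_swap, Prod.snd_swap, hs, CharTwo.add_self_eq_zero]
  · have : a.2 = a.1 := congrArg Prod.fst h
    exact ha (by rw [this, h0])

theorem sum_rotate {ι M : Type*} [Fintype ι] [AddCommMonoid M] (f : ι → ι → ι → M) :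
    ∑ a, ∑ b, ∑ c, f a b c = ∑ c, ∑ a, ∑ b, f a b c := by
  rw [Finset.sum_congr rfl fun a _ => Finset.sum_comm, Finset.sum_comm]

/-- Sorts compositions by the circles they share: none, both as a vertical annulus, or exactly one
in six configurations. Horizontal annuli and overlapping arcs that wrap around contribute zero. -/
theorem pairTerm_eq_sum (v k : Fin n) (φ : Gen n → ZMod 2) (x : Gen n) (l r l' r' : Fin n) :
    pairTerm v k φ x l r l' r' =
      (if l' ≠ l ∧ l' ≠ r ∧ r' ≠ l ∧ r' ≠ r then pairTerm v k φ x l r l' r' else 0) +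
      (if r' = r then if l' = l then pairTerm v k φ x l r l' r' else 0 else 0) +
      ((if l' = r then if IsCyclic l r r' then pairTerm v k φ x l r l' r' else 0 else 0) +
      (if r' = l then if IsCyclic l' l r then pairTerm v k φ x l r l' r' else 0 else 0) +
      (if l' = l then if IsCyclic l r' r then pairTerm v k φ x l r l' r' else 0 else 0) +
      (if l' = l then if IsCyclic l r r' then pairTerm v k φ x l r l' r' else 0 else 0) +
      (if r' = r then if IsCyclic l' l r then pairTerm v k φ x l r l' r' else 0 else 0) +
      (if r' = r then if IsCyclic l l' r then pairTerm v k φ x l r l' r' else 0 else 0)) := by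
  by_cases h0 : pairTerm v k φ x l r l' r' = 0
  · simp [h0]
  have hlr : l ≠ r := fun h => h0 (pairTerm_eq_zero fun h' => absurd h h'.1)
  have hlr' : l' ≠ r' := fun h => h0 (pairTerm_eq_zero fun _ h' => absurd h h'.1)
  by_cases h1 : l' = l
  · subst h1
    by_cases h4 : r' = r
    · subst h4
      simp [hlr, IsCyclic, not_inOpenArc_left, not_inOpenArc_right hlr]
    · rcases IsCyclic.total hlr (Ne.symm h4) hlr' with h | h
      · simp [h4, hlr, hlr'.symm, h, h.not_swap]
      · simp [h4, hlr, hlr'.symm, h, h.not_swap]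
  by_cases h2 : l' = r
  · subst h2
    by_cases h3 : r' = l
    · subst h3
      exact absurd (pairTerm_horizontal _ _) h0
    · have h : IsCyclic l l' r' := (IsCyclic.total hlr hlr' (Ne.symm h3)).resolve_right
        fun h => h0 (pairTerm_eq_zero_of_isCyclic h)
      simp [h1, h3, hlr'.symm, h]
  by_cases h3 : r' = l
  · subst h3
    have h : IsCyclic l' r' r := (IsCyclic.total hlr' hlr h2).resolve_right
        fun h => h0 (pairTerm_eq_zero_of_isCyclic' h)
    simp [h1, h2, hlr, h]
  by_cases h4 : r' = r
  · subst h4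
    rcases IsCyclic.total h1 hlr hlr' with h | h
    · have h' : ¬ IsCyclic l l' r' := fun h' => h.not_swap h'.rotate
      simp [h1, h2, hlr.symm, h, h']
    · have h' : IsCyclic l l' r' := h.rotate.rotate
      simp [h1, h2, hlr.symm, h', h.not_swap]
  · simp [h1, h2, h3, h4]

/-- Disjoint pairs cancel against the same pair in the other order, vertical annuli against each
other, and the six configurations against each other for every cyclic triple. -/
theorem sum_pairTerm (v k : Fin n) (φ : Gen n → ZMod 2) (x : Gen n) :
    ∑ l, ∑ r, ∑ l', ∑ r', pairTerm v k φ x l r l' r' = 0 := by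
  have hd : ∑ l, ∑ r, ∑ l', ∑ r', (if l' ≠ l ∧ l' ≠ r ∧ r' ≠ l ∧ r' ≠ r then
      pairTerm v k φ x l r l' r' else 0) = 0 := by
    have := sum_eq_zero_of_symm (fun a b : Fin n × Fin n =>
      if b.1 ≠ a.1 ∧ b.1 ≠ a.2 ∧ b.2 ≠ a.1 ∧ b.2 ≠ a.2 then
        pairTerm v k φ x a.1 a.2 b.1 b.2 else 0) (fun a b => ?_) (fun a => by simp)
    · simpa only [Fintype.sum_prod_type] using this
    · by_cases h : b.1 ≠ a.1 ∧ b.1 ≠ a.2 ∧ b.2 ≠ a.1 ∧ b.2 ≠ a.2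
      · rw [if_pos h, if_pos ⟨h.1.symm, h.2.2.1.symm, h.2.1.symm, h.2.2.2.symm⟩,
          pairTerm_comm h.1 h.2.1 h.2.2.1 h.2.2.2]
      · rw [if_neg h, if_neg fun h' => h ⟨h'.1.symm, h'.2.2.1.symm, h'.2.1.symm, h'.2.2.2.symm⟩]
  have ht : ∑ p, ∑ q, ∑ w, (if IsCyclic p q w then pairTerm v k φ x p q q w +
      pairTerm v k φ x q w p q + pairTerm v k φ x p w p q + pairTerm v k φ x p q p w +
      pairTerm v k φ x q w p w + pairTerm v k φ x p w q w else 0) = 0 :=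
    Finset.sum_eq_zero fun p _ => Finset.sum_eq_zero fun q _ => Finset.sum_eq_zero fun w _ => by
      split_ifs with h
      · exact pairTerm_sum_isCyclic h
      · rfl
  have hv := sum_pairTerm_vertical (v := v) (k := k) (φ := φ) (x := x)
  rw [Finset.sum_congr rfl fun l _ => Finset.sum_congr rfl fun r _ => Finset.sum_congr rfl
    fun l' _ => Finset.sum_congr rfl fun r' _ => pairTerm_eq_sum v k φ x l r l' r']
  generalize pairTerm v k φ x = g at hd ht hv ⊢
  have hite : ∀ (P : Prop) [Decidable P] (a b : ZMod 2),
      (if P then a + b else 0) = (if P then a else 0) + (if P then b else 0) := by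
    intro P _ a b
    split_ifs <;> simp
  -- The sums are reordered so that the summation variables form the cyclic triple `p, q, w` of
  -- `ht`.
  have e1 := sum_rotate fun l r l' => if IsCyclic l' l r then g l r l' l else 0
  have e2 := sum_rotate fun l r l' => if IsCyclic l' l r then g l r l' r else 0
  have e3 : ∑ l, ∑ r, ∑ r', (if IsCyclic l r' r then g l r l r' else 0) =
      ∑ l, ∑ r', ∑ r, (if IsCyclic l r' r then g l r l r' else 0) :=
    Finset.sum_congr rfl fun _ _ => Finset.sum_comm
  have e4 : ∑ l, ∑ r, ∑ l', (if IsCyclic l l' r then g l r l' r else 0) =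
      ∑ l, ∑ l', ∑ r, (if IsCyclic l l' r then g l r l' r else 0) :=
    Finset.sum_congr rfl fun _ _ => Finset.sum_comm
  simp only [hite, Finset.sum_add_distrib] at ht
  simp only [Finset.sum_add_distrib, Finset.sum_ite_eq', Finset.sum_ite_irrel,
    Finset.sum_const_zero, Finset.mem_univ, if_true]
  rw [hd, hv, e1, e2, e3, e4, zero_add, zero_add]
  exact ht

/-- `sideSum` commutes with `rectSum`. -/
theorem rectSum_sideSum (v k : Fin n) (φ : Gen n → ZMod 2) (x : Gen n) :
    rectSum (sideSum v k φ) x = sideSum v k (rectSum φ) x := by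
  rw [← CharTwo.add_eq_zero, rectSum_sideSum_add, sum_pairTerm]

/-! ### The Maslov grading. -/

/-- The number of markings `(c, π c)` in the rectangle from `x` between the circles `l` and `r`. -/
def markCount (π x : Gen n) (l r : Fin n) : ℤ :=
  ∑ c, (if InArc l r c then 1 else 0) * (if InArc (x l) (x r) (π c) then 1 else 0)

/-- A Maslov grading for the markings `(c, π c)`. -/
def IsGrading (π : Gen n) (M : Gen n → ℤ) : Prop :=
  ∀ x l r, EmptyFrom x l r → M (x * Equiv.swap l r) = M x - 1 + 2 * markCount π x l r

theorem one_le_markCount {π x : Gen n} {l r c : Fin n} (h₁ : InArc l r c)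
    (h₂ : InArc (x l) (x r) (π c)) : 1 ≤ markCount π x l r := by
  refine le_trans ?_ (Finset.single_le_sum (fun c _ => ?_) (Finset.mem_univ c))
  · simp [h₁, h₂]
  · split_ifs <;> simp

theorem two_le_markCount {π x : Gen n} {l r c d : Fin n} (hcd : c ≠ d) (h₁ : InArc l r c)
    (h₂ : InArc (x l) (x r) (π c)) (h₃ : InArc l r d) (h₄ : InArc (x l) (x r) (π d)) :
    2 ≤ markCount π x l r := by
  refine le_trans ?_ (Finset.sum_le_sum_of_subset_of_nonneg (Finset.subset_univ {c, d})
    fun c _ _ => ?_)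
  · rw [Finset.sum_pair hcd]
    simp [h₁, h₂, h₃, h₄]
  · split_ifs <;> simp

section Grading

/-- The integer indicator of `a < b`. -/
def ltInd (a b : Fin n) : ℤ := if a < b then 1 else 0

theorem ltInd_self (a : Fin n) : ltInd a a = 0 := by simp [ltInd]

theorem ltInd_swap {a b : Fin n} (h : a ≠ b) : ltInd b a = 1 - ltInd a b := by
  unfold ltInd
  rcases lt_or_gt_of_ne h with h' | h' <;> simp [h', h'.not_gt]

/-- Makes the arc indicator linear in `ltInd`; the last term accounts for arcs through the origin.
-/
theorem ite_inArc_eq {a b : Fin n} (h : a ≠ b) (c : Fin n) :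
    (if InArc a b c then 1 else 0 : ℤ) = ltInd c b - ltInd c a + ltInd b a := by
  simp only [ltInd, inArc_iff, Fin.lt_def]
  rw [Ne, Fin.ext_iff] at h
  split_ifs <;> omega

/-- The Maslov grading for the markings `(c, π c)`, up to a constant. -/
def maslov (π x : Gen n) : ℤ :=
  (∑ i, ∑ j, ltInd i j * ltInd (x i) (x j)) -
    ∑ i, ∑ c, ((1 - ltInd c i) * (1 - ltInd (π c) (x i)) + ltInd c i * ltInd (π c) (x i))

theorem sum_eq_add_add_sum_erase {M : Type*} [AddCommMonoid M] {l r : Fin n} (h : l ≠ r)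
    (f : Fin n → M) :
    ∑ i, f i = f l + f r + ∑ i ∈ (Finset.univ.erase l).erase r, f i := by
  rw [← Finset.add_sum_erase _ _ (Finset.mem_univ l), ← Finset.add_sum_erase _ _
    (Finset.mem_erase.2 ⟨h.symm, Finset.mem_univ r⟩), add_assoc]

/-- With arc indicators `A`, `B` of the rectangle, both parts of `maslov` change by sums of `(A - ρ)
* (B - σ)`, over the points of `x` and over the markings. As both are permutations, the two sums
differ only in `∑ A * B`, which is 1 for `x` and the marking count for `π`. -/
theorem isGrading_maslov (π : Gen n) : IsGrading π (maslov π) := by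
  rintro x l r ⟨hlr, hE⟩
  set y : Gen n := x * Equiv.swap l r with hy
  have hbt : x l ≠ x r := x.injective.ne hlr
  have yl : y l = x r := by simp [hy]
  have yr : y r = x l := by simp [hy]
  have yc : ∀ c ∈ (Finset.univ.erase l).erase r, y c = x c := by
    intro c hc
    simp only [Finset.mem_erase] at hc
    simp [hy, Equiv.swap_apply_of_ne_of_ne hc.2.1 hc.1]
  set A : Fin n → ℤ := fun c => if InArc l r c then 1 else 0 with hA
  set B : Fin n → ℤ := fun k => if InArc (x l) (x r) k then 1 else 0 with hB
  have eA : ∀ c, A c = ltInd c r - ltInd c l + ltInd r l := ite_inArc_eq hlr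
  have eB : ∀ c, B c = ltInd c (x r) - ltInd c (x l) + ltInd (x r) (x l) := ite_inArc_eq hbt
  set ρ := ltInd r l with hρ
  set σ := ltInd (x r) (x l) with hσ
  have hAl : A l = 1 := by rw [eA, ltInd_swap hlr.symm, ltInd_self]; ring
  have hAr : A r = 0 := by rw [eA, ltInd_self]; ring
  have hBl : B (x l) = 1 := by rw [eB, ltInd_swap hbt.symm, ltInd_self]; ring
  have hBr : B (x r) = 0 := by rw [eB, ltInd_self]; ring
  -- The arcs are half-open, so the lower left corner is counted and the upper right one is not;
  -- emptiness excludes all other points.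
  have hAB : ∑ c, A c * B (x c) = 1 := by
    rw [sum_eq_add_add_sum_erase hlr, hAl, hAr, hBl, Finset.sum_eq_zero, add_zero]
    · ring
    · intro c hc
      simp only [Finset.mem_erase] at hc
      by_contra h0
      refine hE c ⟨⟨?_, hc.2.1⟩, ?_, x.injective.ne hc.2.1⟩ <;> by_contra h <;>
        simp [hA, hB, h] at h0
  have hsum : ∑ c, B (x c) = ∑ c, B (π c) := by rw [Equiv.sum_comp x B, Equiv.sum_comp π B]
  have hpairs : ∑ i, ∑ j, ltInd i j * ltInd (x i) (x j) -
      ∑ i, ∑ j, ltInd i j * ltInd (y i) (y j) =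
      (1 - 2 * ρ) * (1 - 2 * σ) +
        2 * ∑ c ∈ (Finset.univ.erase l).erase r, (A c - ρ) * (B (x c) - σ) := by
    simp only [sum_eq_add_add_sum_erase hlr, Finset.sum_add_distrib, yl, yr, ltInd_self]
    have e0 : ∑ i ∈ (Finset.univ.erase l).erase r, ∑ j ∈ (Finset.univ.erase l).erase r,
        ltInd i j * ltInd (y i) (y j) = ∑ i ∈ (Finset.univ.erase l).erase r,
        ∑ j ∈ (Finset.univ.erase l).erase r, ltInd i j * ltInd (x i) (x j) :=
      Finset.sum_congr rfl fun i hi => Finset.sum_congr rfl fun j hj => by rw [yc i hi, yc j hj]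
    have e1 : 2 * ∑ c ∈ (Finset.univ.erase l).erase r, (A c - ρ) * (B (x c) - σ) =
        ∑ c ∈ (Finset.univ.erase l).erase r, (ltInd l c * ltInd (x l) (x c) +
          ltInd r c * ltInd (x r) (x c) + ltInd c l * ltInd (x c) (x l) +
          ltInd c r * ltInd (x c) (x r) - ltInd l c * ltInd (x r) (y c) -
          ltInd r c * ltInd (x l) (y c) - ltInd c l * ltInd (y c) (x r) -
          ltInd c r * ltInd (y c) (x l)) := by
      rw [Finset.mul_sum]
      refine Finset.sum_congr rfl fun c hc => ?_
      rw [yc c hc, eA, eB]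
      simp only [Finset.mem_erase] at hc
      rw [ltInd_swap hc.1, ltInd_swap hc.2.1, ltInd_swap (x.injective.ne hc.1),
        ltInd_swap (x.injective.ne hc.2.1)]
      ring
    rw [e1, e0]
    simp only [Finset.sum_add_distrib, Finset.sum_sub_distrib]
    rw [ltInd_swap hlr.symm, ltInd_swap hbt.symm]
    ring
  have hmarks : (∑ i, ∑ c, ((1 - ltInd c i) * (1 - ltInd (π c) (x i)) +
      ltInd c i * ltInd (π c) (x i))) - (∑ i, ∑ c, ((1 - ltInd c i) * (1 - ltInd (π c) (y i)) +
      ltInd c i * ltInd (π c) (y i))) = 2 * ∑ c, (A c - ρ) * (B (π c) - σ) := by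
    set F : Fin n → Fin n → ℤ := fun i k => ∑ c, ((1 - ltInd c i) * (1 - ltInd (π c) k) +
      ltInd c i * ltInd (π c) k) with hF
    have hxy : ∑ i ∈ (Finset.univ.erase l).erase r, F i (y i) =
        ∑ i ∈ (Finset.univ.erase l).erase r, F i (x i) :=
      Finset.sum_congr rfl fun i hi => by rw [yc i hi]
    change ∑ i, F i (x i) - ∑ i, F i (y i) = _
    rw [sum_eq_add_add_sum_erase hlr fun i => F i (x i),
      sum_eq_add_add_sum_erase hlr fun i => F i (y i), hxy, yl, yr, add_sub_add_right_eq_sub]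
    simp only [hF]
    rw [← Finset.sum_add_distrib, ← Finset.sum_add_distrib, ← Finset.sum_sub_distrib,
      Finset.mul_sum]
    refine Finset.sum_congr rfl fun c _ => ?_
    rw [eA, eB]
    ring
  have hx := sum_eq_add_add_sum_erase hlr fun c => (A c - ρ) * (B (x c) - σ)
  have e : ∀ z : Gen n, ∑ c, (A c - ρ) * (B (z c) - σ) =
      ∑ c, A c * B (z c) - σ * ∑ c, A c - ρ * ∑ c, B (z c) + n * (ρ * σ) := by
    intro z
    simp only [Finset.mul_sum, ← Finset.sum_sub_distrib]
    rw [show (n : ℤ) * (ρ * σ) = ∑ _c : Fin n, ρ * σ by simp, ← Finset.sum_add_distrib]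
    exact Finset.sum_congr rfl fun c _ => by ring
  rw [e x, hAB, hsum, hAl, hAr, hBl, hBr] at hx
  rw [e π] at hmarks
  change maslov π y = maslov π x - 1 + 2 * ∑ c, A c * B (π c)
  unfold maslov
  linear_combination -hpairs + hmarks + 2 * hx

end Grading

/-! ### Cocycles by induction over adjacent transpositions. -/

/-- A cocycle for the complex of all empty rectangles that does not vanish on the generator of the
lower left corners of the markings `(c, π c)` and is supported in its degree and below. -/
def HasCocycle (π : Gen n) : Prop :=
  ∃ (M : Gen n → ℤ) (φ : Gen n → ZMod 2), IsGrading π M ∧ (∀ x, rectSum φ x = 0) ∧ φ π = 1 ∧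
    ∀ y, φ y ≠ 0 → M y ≤ M π

/-- Only generators `swap l r` have rectangles to the identity. There are exactly two, over the arcs
from `l` to `r` and from `r` to `l`; both are empty, so they cancel modulo 2. -/
theorem hasCocycle_one : HasCocycle (1 : Gen n) := by
  refine ⟨maslov 1, fun y => if y = 1 then 1 else 0, isGrading_maslov 1, fun x => ?_, if_pos rfl,
    fun y hy => ?_⟩
  · refine sum_eq_zero_of_symm _ (fun l r => ?_) fun l => if_neg fun h => h.1 rfl
    by_cases h : x * Equiv.swap l r = 1
    · have hx : x = Equiv.swap l r := by
        rw [mul_eq_one_iff_eq_inv.1 h, Equiv.swap_inv]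
      have hE : ∀ {l r : Fin n}, l ≠ r → EmptyFrom (Equiv.swap l r) l r := by
        refine fun {l r} hlr => ⟨hlr, fun c hc => ?_⟩
        rw [Equiv.swap_apply_left, Equiv.swap_apply_right,
          Equiv.swap_apply_of_ne_of_ne hc.1.ne_left (hc.1.ne_right hlr)] at hc
        exact hc.1.not_swap hlr hc.2
      by_cases hlr : l = r
      · rw [hlr]
      · rw [hx, if_pos (hE hlr), Equiv.swap_comm l r, if_pos (hE (Ne.symm hlr))]
    · simp [h, Equiv.swap_comm r l]
  · by_cases h : y = 1
    · rw [h]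
    · exact absurd (if_neg h) hy

/-- The marked points after `a` and up to `b`. -/
def InArc' (a b c : Fin n) : Prop := c ≠ a ∧ (InArc a b c ∨ c = b)

instance (a b c : Fin n) : Decidable (InArc' a b c) := by unfold InArc'; infer_instance

section Step

variable {c v : Fin n}

/-- The adjacent columns `c` and `v` are separated only by the circle `v`, so membership changes
only where an arc begins or ends there. -/
theorem ite_inArc_sub (hcv : (v : ℕ) = c + 1) (l r : Fin n) :
    (if InArc l r c then 1 else 0 : ℤ) - (if InArc l r v then 1 else 0) =
      (if r = v then 1 else 0) - (if l = v then 1 else 0) := by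
  simp only [inArc_iff, Fin.ext_iff]
  split_ifs <;> omega

/-- Going up from `s` to `t`, the indicator of `InArc' a b` rises across the unit interval after `a`
and drops across the one after `b`. -/
theorem ite_inArc'_sub {a b s t : Fin n} (hab : a ≠ b) (hst : s ≠ t) :
    (if InArc' a b s then 1 else 0 : ℤ) - (if InArc' a b t then 1 else 0) =
      (if InArc s t b then 1 else 0) - (if InArc s t a then 1 else 0) := by
  simp only [InArc', inArc_iff, Ne, Fin.ext_iff] at *
  split_ifs <;> omega

/-- The count changes only for rectangles with a side on `v`, and the change depends only on the old
and new heights on `v`. Hence a grading for the interchanged markings can be corrected to one for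
`π`. -/
theorem markCount_mul_swap (hcv : (v : ℕ) = c + 1) {π x : Gen n} {l r : Fin n} (h : l ≠ r) :
    markCount (π * Equiv.swap c v) x l r = markCount π x l r +
      ((if InArc' (π c) (π v) ((x * Equiv.swap l r) v) then 1 else 0) -
        (if InArc' (π c) (π v) (x v) then 1 else 0)) := by
  have hne : c ≠ v := by rw [Ne, Fin.ext_iff]; omega
  have h1 := ite_inArc_sub hcv l r
  have h2 := ite_inArc'_sub (π.injective.ne hne) (x.injective.ne h)
  unfold markCount
  rw [sum_eq_add_add_sum_erase hne, sum_eq_add_add_sum_erase hne,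
    Finset.sum_congr rfl fun i (hi : i ∈ (Finset.univ.erase c).erase v) => by
      simp only [Finset.mem_erase] at hi
      rw [Equiv.Perm.mul_apply, Equiv.swap_apply_of_ne_of_ne hi.2.1 hi.1]]
  simp only [Equiv.Perm.mul_apply, Equiv.swap_apply_left, Equiv.swap_apply_right]
  by_cases hr : r = v
  · subst hr
    rw [if_pos rfl, if_neg h] at h1
    simp only [Equiv.swap_apply_right]
    linear_combination ((if InArc (x l) (x r) (π r) then 1 else 0) -
      (if InArc (x l) (x r) (π c) then 1 else 0)) * h1 - h2
  by_cases hl : l = v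
  · subst hl
    rw [if_neg hr, if_pos rfl] at h1
    simp only [Equiv.swap_apply_left]
    linear_combination ((if InArc (x l) (x r) (π l) then 1 else 0) -
      (if InArc (x l) (x r) (π c) then 1 else 0)) * h1 + h2
  · rw [if_neg hr, if_neg hl] at h1
    simp only [Equiv.swap_apply_of_ne_of_ne (Ne.symm hl) (Ne.symm hr)]
    linear_combination ((if InArc (x l) (x r) (π v) then 1 else 0) -
      (if InArc (x l) (x r) (π c) then 1 else 0)) * h1

theorem inArc_of_succ (hcv : (v : ℕ) = c + 1) (l : Fin n) : InArc l v c := by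
  rw [inArc_iff]
  omega

theorem inArc'_or_inArc {a b s t : Fin n} (h : InArc s t a) :
    InArc' a b t ∨ InArc s t b := by
  simp only [InArc', inArc_iff, Ne, Fin.ext_iff] at *
  omega

theorem inArc'_of_inArc {a b t : Fin n} (hbt : b ≠ t) (h : InArc b t a) : InArc' a b t := by
  simp only [InArc', inArc_iff, Ne, Fin.ext_iff] at *
  omega

/-- Interchanging the markings of two adjacent columns. -/
theorem HasCocycle.of_mul_swap (hcv : (v : ℕ) = c + 1) {π : Gen n}
    (h : HasCocycle (π * Equiv.swap c v)) : HasCocycle π := by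
  obtain ⟨M', φ, hM', hφ, hφ1, hle⟩ := h
  have hne : c ≠ v := by rw [Ne, Fin.ext_iff]; omega
  have hab := π.injective.ne hne
  -- The indicator absorbs the change in `markCount_mul_swap`; the constant 1 normalizes `M` so that
  -- `htop` holds.
  set M : Gen n → ℤ := fun y => M' y + 1 - 2 * (if InArc' (π c) (π v) (y v) then 1 else 0) with hM
  have hgr : IsGrading π M := by
    intro x l r hE
    have h1 := hM' x l r hE
    rw [markCount_mul_swap hcv hE.1] at h1
    simp only [hM]
    linear_combination h1
  have hempty : EmptyFrom π c v := by
    refine ⟨hne, fun d hd => ?_⟩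
    have := hd.1
    rw [inOpenArc_iff] at this
    omega
  have hcount : markCount π π c v = 1 := by
    unfold markCount
    rw [Finset.sum_eq_single c]
    · rw [if_pos (inArc_left hne), if_pos (inArc_left hab), one_mul]
    · intro d _ hd
      rw [if_neg, zero_mul]
      rw [inArc_iff]
      rw [Ne, Fin.ext_iff] at hd
      omega
    · simp
  have htop : M' (π * Equiv.swap c v) = M π := by
    have h1 := hgr π c v hempty
    rw [hcount] at h1
    have h2 : ¬ InArc' (π c) (π v) (π c) := fun h => h.1 rfl
    simp only [hM, Equiv.Perm.mul_apply, Equiv.swap_apply_right, h2, if_false] at h1 ⊢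
    linarith
  -- If the end of the rectangle lies in the support of `φ`, this and `htop` give that `M y` is at
  -- most `M π + 2` minus twice the bracket. The support bound needs the bracket to be at least 1;
  -- at `y = π` it must be at most 1.
  have hdeg : ∀ y l r, EmptyFrom y l r → M' (y * Equiv.swap l r) = M y - 2 +
      2 * (markCount π y l r +
        if InArc' (π c) (π v) ((y * Equiv.swap l r) v) then 1 else 0) := by
    intro y l r hE
    have h1 := hgr y l r hE
    simp only [hM] at h1 ⊢
    linarith
  have hnonneg : ∀ y, (0 : ℤ) ≤ if InArc' (π c) (π v) y then 1 else 0 := by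
    intro y
    split_ifs <;> simp
  refine ⟨M, sideSum v (π c) φ, hgr, fun x => ?_, ?_, fun y hy => ?_⟩
  · rw [rectSum_sideSum, funext hφ]
    simp [sideSum]
  · have key : ∀ l r, EmptyFrom π l r ∧ HasSide v (π c) π l r → φ (π * Equiv.swap l r) ≠ 0 →
        l = c ∧ r = v := by
      rintro l r ⟨hE, hv, hk⟩ h0
      have h1 := hle _ h0
      rw [htop, hdeg _ _ _ hE] at h1
      by_cases hr : r = v
      · subst hr
        refine ⟨?_, rfl⟩
        by_contra hl
        have h2 := two_le_markCount (π := π) (x := π) (Ne.symm hl) (inArc_of_succ hcv l) hk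
          (inArc_left hE.1) (inArc_left (π.injective.ne hE.1))
        have h3 := hnonneg ((π * Equiv.swap l r) r)
        omega
      · obtain rfl := hv.resolve_right hr
        have h2 := one_le_markCount (π := π) (x := π) (inArc_left hE.1)
          (inArc_left (π.injective.ne hE.1))
        have h3 := inArc'_of_inArc (π.injective.ne hE.1) hk
        simp only [Equiv.Perm.mul_apply, Equiv.swap_apply_left, h3, if_true] at h1
        omega
    have hzero : ∀ l r, ¬ (l = c ∧ r = v) → (if EmptyFrom π l r ∧ HasSide v (π c) π l r then
        φ (π * Equiv.swap l r) else 0) = 0 := by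
      intro l r hlr
      split_ifs with h
      · by_contra h0
        exact hlr (key l r h h0)
      · rfl
    unfold sideSum
    rw [Finset.sum_eq_single c, Finset.sum_eq_single v,
      if_pos ⟨hempty, Or.inr rfl, inArc_left hab⟩, hφ1]
    · exact fun r _ hr => hzero c r fun h => hr h.2
    · simp
    · exact fun l _ hl => Finset.sum_eq_zero fun r _ => hzero l r fun h => hl h.1
    · simp
  · obtain ⟨l, -, hl⟩ := Finset.exists_ne_zero_of_sum_ne_zero hy
    obtain ⟨r, -, hr⟩ := Finset.exists_ne_zero_of_sum_ne_zero hl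
    obtain ⟨⟨hE, hv, hk⟩, h0⟩ := ite_ne_right_iff.1 hr
    have h1 := hle _ h0
    rw [htop, hdeg _ _ _ hE] at h1
    have h2 := hnonneg ((y * Equiv.swap l r) v)
    by_cases hr : r = v
    · subst hr
      have h3 := one_le_markCount (π := π) (x := y) (inArc_of_succ hcv l) hk
      omega
    · obtain rfl := hv.resolve_right hr
      -- With left side on `v` and height `π c` covered, the rectangle either contains the marking
      -- of column `v` or has its top in the arc after `π c` up to `π v`.
      rcases inArc'_or_inArc (b := π l) hk with h3 | h3
      · have h4 : 0 ≤ markCount π y l r := Finset.sum_nonneg fun c _ => by split_ifs <;> simp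
        simp only [Equiv.Perm.mul_apply, Equiv.swap_apply_left, h3, if_true] at h1
        omega
      · have h4 := one_le_markCount (π := π) (x := y) (inArc_left hE.1) h3
        omega

end Step

theorem hasCocycle (π : Gen n) : HasCocycle π := by
  obtain _ | m := n
  · rw [Subsingleton.elim π 1]
    exact hasCocycle_one
  have hπ : π ∈ Submonoid.closure
      (Set.range fun i : Fin m => Equiv.swap i.castSucc i.succ) := by
    rw [Equiv.Perm.mclosure_swap_castSucc_succ]
    trivial
  induction hπ using Submonoid.closure_induction_right with
  | one => exact hasCocycle_one
  | mul_right π _ s hs ih =>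
    obtain ⟨i, rfl⟩ := hs
    refine HasCocycle.of_mul_swap (c := i.castSucc) (v := i.succ) (by simp) ?_
    rwa [mul_assoc, Equiv.swap_mul_self, mul_one]

/-! ### From all empty rectangles to those without markings. -/

/-- `ψ` is a cocycle for the complex of the empty rectangles without markings `(c, π c)`. -/
def IsLinkCocycle (π : Gen n) (ψ : Gen n → ZMod 2) : Prop :=
  ∀ x, ∑ l, ∑ r, (if EmptyFrom x l r ∧ markCount π x l r = 0 then ψ (x * Equiv.swap l r) else 0) = 0

theorem markCount_nonneg (π x : Gen n) (l r : Fin n) : 0 ≤ markCount π x l r :=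
  Finset.sum_nonneg fun c _ => by split_ifs <;> simp

theorem exists_isLinkCocycle (π : Gen n) : ∃ ψ, IsLinkCocycle π ψ ∧ ψ π = 1 := by
  obtain ⟨M, φ, hM, hφ, hφ1, hle⟩ := hasCocycle π
  refine ⟨fun y => if M y = M π then φ y else 0, fun x => ?_, by simp [hφ1]⟩
  by_cases hx : M x = M π + 1
  · refine Eq.trans ?_ (hφ x)
    unfold rectSum
    refine Finset.sum_congr rfl fun l _ => Finset.sum_congr rfl fun r _ => ?_
    by_cases hE : EmptyFrom x l r
    · have h1 := hM x l r hE
      by_cases h0 : markCount π x l r = 0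
      · rw [if_pos ⟨hE, h0⟩, if_pos hE]
        exact if_pos (by rw [h1, h0, hx]; ring)
      · rw [if_neg fun h => h0 h.2, if_pos hE, eq_comm]
        by_contra h
        -- A rectangle with a marking would end in degree at least `M π + 2`, above the support of
        -- `φ`.
        have h2 := hle _ h
        have h3 := markCount_nonneg π x l r
        omega
    · rw [if_neg fun h => hE h.1, if_neg hE]
  · refine Finset.sum_eq_zero fun l _ => Finset.sum_eq_zero fun r _ => ?_
    by_cases h : EmptyFrom x l r ∧ markCount π x l r = 0
    · have h1 := hM x l r h.1
      rw [h.2] at h1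
      rw [if_pos h]
      exact if_neg (by omega)
    · rw [if_neg h]

/-! ### The half turn of the torus. -/

section Rotation

theorem inOpenArc_rev {a b c : Fin n} :
    InOpenArc (Fin.rev b) (Fin.rev a) (Fin.rev c) ↔ InOpenArc a b c := by
  simp only [inOpenArc_iff, Fin.val_rev]
  omega

/-- Reflection reverses the unit interval from `c` to `c + 1`, so the image starts at the image of
`c + 1`; hence the shift by `finRotate`. -/
theorem inArc_rev_finRotate {a b c : Fin n} (h : a ≠ b) :
    InArc (Fin.rev b) (Fin.rev a) (Fin.rev (finRotate n c)) ↔ InArc a b c := by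
  obtain _ | m := n
  · exact c.elim0
  simp only [inArc_iff, Fin.val_rev]
  rw [Ne, Fin.ext_iff] at h
  rcases eq_or_ne c (Fin.last m) with hc | hc
  · subst hc
    rw [finRotate_last, Fin.val_zero, Fin.val_last]
    omega
  · rw [coe_finRotate_of_ne_last hc]
    have : (c : ℕ) ≠ m := fun e => hc (Fin.ext e)
    omega

/-- The image of a generator under the rotation of the torus by a half turn. -/
def rotateGen (x : Gen n) : Gen n := Fin.revPerm * x * Fin.revPerm

theorem rotateGen_apply_rev (x : Gen n) (c : Fin n) :
    rotateGen x (Fin.rev c) = Fin.rev (x c) := by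
  simp [rotateGen]

theorem rotateGen_mul_swap (x : Gen n) (l r : Fin n) :
    rotateGen (x * Equiv.swap l r) = rotateGen x * Equiv.swap (Fin.rev r) (Fin.rev l) := by
  have h := Equiv.mul_swap_eq_swap_mul (Fin.revPerm : Gen n) (Fin.rev l) (Fin.rev r)
  rw [Fin.revPerm_apply, Fin.revPerm_apply, Fin.rev_rev, Fin.rev_rev] at h
  rw [rotateGen, rotateGen, Equiv.swap_comm (Fin.rev r), mul_assoc _ Fin.revPerm, h]
  simp only [mul_assoc]

theorem emptyFrom_rotateGen {x : Gen n} {l r : Fin n} :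
    EmptyFrom (rotateGen x) (Fin.rev r) (Fin.rev l) ↔ EmptyFrom x l r := by
  unfold EmptyFrom
  rw [Fin.rev_surjective.forall, Ne, Fin.rev_inj, eq_comm]
  simp only [rotateGen_apply_rev, inOpenArc_rev]

/-- The images of the markings under the rotation of the torus by a half turn. -/
def rotateMark (π : Gen n) : Gen n := rotateGen (finRotate n * π * (finRotate n)⁻¹)

theorem rotateMark_apply (π : Gen n) (c : Fin n) :
    rotateMark π (Fin.rev (finRotate n c)) = Fin.rev (finRotate n (π c)) := by
  rw [rotateMark, rotateGen_apply_rev, Equiv.Perm.mul_apply, Equiv.Perm.mul_apply]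
  exact congrArg (fun c => Fin.rev (finRotate n (π c))) ((finRotate n).symm_apply_apply c)

theorem markCount_rotateGen {π x : Gen n} {l r : Fin n} (h : l ≠ r) :
    markCount (rotateMark π) (rotateGen x) (Fin.rev r) (Fin.rev l) = markCount π x l r := by
  unfold markCount
  rw [← Equiv.sum_comp ((finRotate n).trans Fin.revPerm)]
  simp only [Equiv.trans_apply, Fin.revPerm_apply, rotateMark_apply, rotateGen_apply_rev,
    inArc_rev_finRotate h, inArc_rev_finRotate (x.injective.ne h)]

/-- The half turn matches rectangles from `x` with rectangles from `rotateGen x`, exchanging left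
and right sides and preserving emptiness and marking counts. -/
theorem IsLinkCocycle.comp_rotateGen {π : Gen n} {ψ : Gen n → ZMod 2}
    (h : IsLinkCocycle (rotateMark π) ψ) : IsLinkCocycle π fun x => ψ (rotateGen x) := by
  intro x
  set F : Fin n → Fin n → ZMod 2 := fun l r =>
    if EmptyFrom (rotateGen x) l r ∧ markCount (rotateMark π) (rotateGen x) l r = 0 then
      ψ (rotateGen x * Equiv.swap l r) else 0 with hF
  have hx : ∑ l, ∑ r, F l r = 0 := h (rotateGen x)
  refine Eq.trans ?_ hx
  rw [Finset.sum_comm, ← Equiv.sum_comp Fin.revPerm fun l => ∑ r, F l r]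
  refine Finset.sum_congr rfl fun r _ => ?_
  rw [← Equiv.sum_comp Fin.revPerm fun l => F (Fin.revPerm r) l]
  refine Finset.sum_congr rfl fun l _ => ?_
  simp only [hF, Fin.revPerm_apply, rotateGen_mul_swap, emptyFrom_rotateGen]
  refine if_congr (and_congr_right fun hE => ?_) rfl rfl
  rw [markCount_rotateGen hE.1]

end Rotation

/-! ### Comparison with the link complex over `ℤ[U_1, …, U_n]`. -/

section Bridge

variable (G : GridDiagram n)

theorem avoidsX_iff_markCount (r : Rectangle n) (x : Gen n) (hl : x r.left = r.bottom)
    (hr : x r.right = r.top) : G.AvoidsX r ↔ markCount G.xRow x r.left r.right = 0 := by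
  have h0 : ∀ c ∈ Finset.univ, (0 : ℤ) ≤ (if InArc r.left r.right c then 1 else 0) *
      (if InArc (x r.left) (x r.right) (G.xRow c) then 1 else 0) :=
    fun c _ => by split_ifs <;> simp
  unfold AvoidsX Rectangle.ContainsSquare markCount
  rw [Finset.sum_eq_zero_iff_of_nonneg h0, hl, hr]
  simp only [Finset.mem_univ, true_imp_iff, mul_eq_zero, ite_eq_right_iff, one_ne_zero, imp_false,
    not_and_or]

/-- The rectangle from `x` between the vertical circles `l` and `r`. -/
def rectangleFrom (x : Gen n) {l r : Fin n} (h : l ≠ r) : Rectangle n :=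
  ⟨l, r, x l, x r, h, x.injective.ne h⟩

theorem connects_rectangleFrom (x : Gen n) {l r : Fin n} (h : l ≠ r) :
    (rectangleFrom x h).Connects x (x * Equiv.swap l r) := by
  refine ⟨rfl, rfl, by simp [rectangleFrom], by simp [rectangleFrom], fun c hl hr => ?_⟩
  exact congrArg x (Equiv.swap_apply_of_ne_of_ne hl hr).symm

theorem Rectangle.Connects.eq_mul_swap {r : Rectangle n} {x y : Gen n} (h : r.Connects x y) :
    y = x * Equiv.swap r.left r.right := by
  obtain ⟨h1, h2, h3, h4, h5⟩ := h
  ext c : 1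
  rw [Equiv.Perm.mul_apply]
  by_cases hl : c = r.left
  · rw [hl, Equiv.swap_apply_left, h4, h2]
  by_cases hr : c = r.right
  · rw [hr, Equiv.swap_apply_right, h3, h1]
  rw [Equiv.swap_apply_of_ne_of_ne hl hr, h5 c hl hr]

/-- The rectangles that connect `x` to some generator correspond to the ordered pairs of distinct
vertical circles. -/
def rectEquiv (x : Gen n) : (Σ y : Gen n, Rect x y) ≃ {p : Fin n × Fin n // p.1 ≠ p.2} where
  toFun s := ⟨(s.2.1.left, s.2.1.right), s.2.1.left_ne_right⟩
  invFun p := ⟨x * Equiv.swap p.1.1 p.1.2, rectangleFrom x p.2, connects_rectangleFrom x p.2⟩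
  left_inv := by
    rintro ⟨y, ⟨l, r, b, t, hlr, hbt⟩, h⟩
    obtain rfl := h.eq_mul_swap
    have hb : b = x l := h.1.symm
    have ht : t = x r := h.2.1.symm
    subst hb ht
    rfl
  right_inv _ := rfl

open Classical in
theorem sum_rect_eq (ψ : Gen n → ZMod 2) (x : Gen n) :
    ∑ y : Gen n, ∑ r : Rect x y, (if r.1.IsEmptyFor x ∧ G.AvoidsX r.1 then ψ y else 0) =
      ∑ l, ∑ r, (if EmptyFrom x l r ∧ markCount G.xRow x l r = 0 then
        ψ (x * Equiv.swap l r) else 0) := by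
  rw [← Fintype.sum_sigma' (fun (y : Gen n) (r : Rect x y) =>
      if r.1.IsEmptyFor x ∧ G.AvoidsX r.1 then ψ y else 0),
    ← Fintype.sum_prod_type' (fun l r => if EmptyFrom x l r ∧ markCount G.xRow x l r = 0 then
        ψ (x * Equiv.swap l r) else 0),
    ← Finset.sum_filter_of_ne (p := fun p : Fin n × Fin n => p.1 ≠ p.2) fun p _ hp h =>
      hp (if_neg fun h' => h'.1.1 h),
    Finset.sum_subtype (p := fun p : Fin n × Fin n => p.1 ≠ p.2) _ (by simp)]
  refine Fintype.sum_equiv (rectEquiv x) _ _ fun s => ?_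
  obtain ⟨y, r, h⟩ := s
  obtain rfl := h.eq_mul_swap
  refine if_congr (and_congr ?_ (G.avoidsX_iff_markCount r x h.1 h.2.1)) rfl rfl
  change _ ↔ EmptyFrom x r.left r.right
  rw [EmptyFrom, and_iff_right r.left_ne_right, h.1, h.2.1]
  rfl

variable {G}

/-- The reduction of `ℤ[U_1, …, U_n]` modulo `2` and `U_i - 1`. -/
noncomputable def evalOne (n : ℕ) : URing n →+* ZMod 2 :=
  MvPolynomial.eval₂Hom (Int.castRingHom (ZMod 2)) fun _ => 1

theorem evalOne_unit (ε : ℤˣ) : evalOne n ((ε : ℤ) : URing n) = 1 := by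
  rw [map_intCast]
  rcases Int.units_eq_one_or ε with rfl | rfl <;> decide

theorem evalOne_X (i : Fin n) : evalOne n (MvPolynomial.X i) = 1 :=
  MvPolynomial.eval₂Hom_X' _ _ _

/-- The value of a function on the generators on a chain reduced modulo `2` and `U_i - 1`. -/
noncomputable def pairing (ψ : Gen n → ZMod 2) : (Gen n →₀ URing n) →+ ZMod 2 :=
  Finsupp.liftAddHom fun y => (AddMonoidHom.mulRight (ψ y)).comp (evalOne n).toAddMonoidHom

theorem pairing_single (ψ : Gen n → ZMod 2) (y : Gen n) (a : URing n) :
    pairing ψ (Finsupp.single y a) = evalOne n a * ψ y := by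
  simp [pairing]

theorem pairing_smul (ψ : Gen n → ZMod 2) (a : URing n) (w : Gen n →₀ URing n) :
    pairing ψ (a • w) = evalOne n a * pairing ψ w := by
  induction w using Finsupp.induction_linear with
  | zero => simp
  | add f g hf hg => rw [smul_add, map_add, map_add, hf, hg, mul_add]
  | single y b =>
    rw [Finsupp.smul_single, pairing_single, pairing_single, smul_eq_mul, map_mul, mul_assoc]

/-- Under `evalOne` every sign and every power of a `U_i` becomes 1, so on a generator this is the
cocycle condition. -/
theorem pairing_dLink (S : G.SignAssignment) {ψ : Gen n → ZMod 2} (hψ : IsLinkCocycle G.xRow ψ)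
    (w : Gen n →₀ URing n) : pairing ψ (G.dLink S w) = 0 := by
  classical
  induction w using Finsupp.induction_linear with
  | zero => simp
  | add f g hf hg => rw [map_add, map_add, hf, hg, add_zero]
  | single x a =>
    unfold dLink differential
    rw [Finsupp.linearCombination_single, pairing_smul, map_sum, ← mul_zero (evalOne n a),
      ← hψ x, ← G.sum_rect_eq ψ x]
    congr 1
    refine Finset.sum_congr rfl fun y _ => ?_
    rw [map_sum]
    refine Finset.sum_congr rfl fun r _ => ?_
    rw [apply_ite (pairing ψ), map_zero]
    refine if_congr Iff.rfl ?_ rfl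
    rw [pairing_single, map_mul, evalOne_unit, map_prod,
      Finset.prod_eq_one fun i _ => by rw [map_pow, evalOne_X, one_pow], one_mul, one_mul]

/-- A generator on which a cocycle does not vanish represents a class that is not annihilated by
any polynomial that is odd at `U_1 = … = U_n = 1`. -/
theorem smul_mk_ne_zero (S : G.SignAssignment) {ψ : Gen n → ZMod 2}
    (hψ : IsLinkCocycle G.xRow ψ) {x : Gen n} (hx : ψ x = 1) (ε : ℤˣ)
    (z : LinearMap.ker (G.dLink S)) (hz : z.1 = Finsupp.single x ((ε : ℤ) : URing n))
    {p : URing n} (hp : evalOne n p = 1) :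
    p • (Submodule.Quotient.mk z : G.HFLMinus S) ≠ 0 := by
  rw [← Submodule.Quotient.mk_smul, Ne, Submodule.Quotient.mk_eq_zero]
  intro h
  obtain ⟨w, hw⟩ : p • z.1 ∈ LinearMap.range (G.dLink S) := h
  have h1 := congrArg (pairing ψ) hw
  rw [pairing_dLink S hψ, pairing_smul, hz, pairing_single, evalOne_unit, hp, hx] at h1
  exact absurd h1 (by decide)

end Bridge

end GridDiagram

theorem theorem7p3 {n : ℕ} (G : GridDiagram n) (S : G.SignAssignment) (εp εm : ℤˣ) :
    (G.lambdaPlus S εp ≠ 0 ∧ G.lambdaMinus S εm ≠ 0) ∧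
      ∀ i : Fin n, ¬ G.IsUTorsion S i (G.lambdaPlus S εp) ∧
        ¬ G.IsUTorsion S i (G.lambdaMinus S εm) := by
  obtain ⟨ψ, hψ, hψ1⟩ := GridDiagram.exists_isLinkCocycle G.xRow
  obtain ⟨χ, hχ, hχ1⟩ := GridDiagram.exists_isLinkCocycle (GridDiagram.rotateMark G.xRow)
  -- By definition `rotateMark G.xRow` is `rotateGen G.xPlus`, so `hχ1` is already the value of the
  -- rotated cocycle at `x⁺`.
  have hp : ∀ p, GridDiagram.evalOne n p = 1 → p • G.lambdaPlus S εp ≠ 0 := fun p =>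
    GridDiagram.smul_mk_ne_zero S hχ.comp_rotateGen (x := G.xPlus) hχ1 εp _ rfl
  have hm : ∀ p, GridDiagram.evalOne n p = 1 → p • G.lambdaMinus S εm ≠ 0 := fun p =>
    GridDiagram.smul_mk_ne_zero S hψ (x := G.xMinus) hψ1 εm _ rfl
  have hX : ∀ (i : Fin n) (d : ℕ),
      GridDiagram.evalOne n (MvPolynomial.X i ^ d) = 1 := fun i d => by
    rw [map_pow, GridDiagram.evalOne_X, one_pow]
  refine ⟨⟨?_, ?_⟩, fun i => ⟨?_, ?_⟩⟩
  · simpa using hp 1 (map_one _)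
  · simpa using hm 1 (map_one _)
  · rintro ⟨d, -, hd⟩
    exact hp _ (hX i d) hd
  · rintro ⟨d, -, hd⟩
    exact hm _ (hX i d) hd
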